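/- Let $R$ be a commutative ring, $f\ge g\ge 0$ integers, $\Phi=(c_{ij})$ a $g\times f$ matrix over $R$, $M=\operatorname{coker}(\Phi:R^f\to R^g)$, and $L$ a finitely generated $R$-module. Let $S=R[T_1,\dots,T_g]$ with its standard grading, $\mathfrak t=(T_1,\dots,T_g)$, and $\gamma_j=\sum_{i=1}^g c_{ij}T_i$ for $1\le j\le f$. Let $K_\bullet(\gamma;S)$ be the graded Koszul complex of $\gamma_1,\dots,\gamma_f$ over $S$, so that $K_p(\gamma;S)_\nu=\bigwedge^pR^f\otimes_R S_{\nu-p}$; let $C^\bullet_{\mathfrak t}$ be the Čech complex of $T_1,\dots,T_g$ over $S$, let $H^g_{\mathfrak t}(S)$ be its cohomology in degree $g$, and let $K_\bullet(\gamma;H^g_{\mathfrak t}(S))=K_\bullet(\gamma;S)\otimes_S H^g_{\mathfrak t}(S)$, with $K_p(\gamma;H^g_{\mathfrak t}(S))_\nu=\bigwedge^pR^f\otimes_R H^g_{\mathfrak t}(S)_{\nu-p}$. For an integer $\nu$ let $\tau_\nu:K_{g+\nu}(\gamma;H^g_{\mathfrak t}(S))_\nu\to K_\nu(\gamma;S)_\nu$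 be the edge map of the spectral sequences of the double complex $K_\bullet(\gamma;S)\otimes_SC^\bullet_{\mathfrak t}$ in degree $\nu$: it is the unique $R$-linear map such that, for every cycle $z$ of degree $\nu$ and total homological degree $\nu$ in the total complex, $\tau_\nu$ sends the class of the component of $z$ in $K_{g+\nu}(\gamma;S)\otimes C^g_{\mathfrak t}$ to the component of $z$ in $K_\nu(\gamma;S)\otimes C^0_{\mathfrak t}=K_\nu(\gamma;S)$. The complex $\mathfrak B_\bullet(\Phi,\nu)$ of $R$-modules is defined as follows. * If $\nu<0$, it is $K_\bullet(\gamma;H^g_{\mathfrak t}(S))_\nu$, with $\mathfrak B_i(\Phi,\nu)=K_{g+\nu+i}(\gamma;H^g_{\mathfrak t}(S))_\nu$. * If $0\le\nu\le f-g$, it is the splice of $K_\bullet(\gamma;H^g_{\mathfrak t}(S))_\nu$ and $K_\bullet(\gamma;S)_\nu$ via $\tau_\nu$: $$0\to K_f(\gamma;H^g_{\mathfrak t}(S))_\nu\to\cdots\to K_{g+\nu}(\gamma;H^g_{\mathfrak t}(S))_\nu\xrightarrow{\ \tau_\nu\ }K_\nu(\gamma;S)_\nu\to\cdots\to K_0(\gamma;S)_\nu\to0,$$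 with $\mathfrak B_i(\Phi,\nu)=K_i(\gamma;S)_\nu$ for $i\le\nu$ and $\mathfrak B_i(\Phi,\nu)=K_{i-1+g}(\gamma;H^g_{\mathfrak t}(S))_\nu$ for $i>\nu$. * If $\nu>f-g$, it is $K_\bullet(\gamma;S)_\nu$, with $\mathfrak B_i(\Phi,\nu)=K_i(\gamma;S)_\nu$. These are the Buchsbaum–Eisenbud complexes (generalized Koszul complexes of Kirby). Put $\mathfrak B_\bullet(\Phi,L,\nu)=\mathfrak B_\bullet(\Phi,\nu)\otimes_RL$. Then for all integers $i$ and $\nu$, $$\operatorname{Supp}_R H_i(\mathfrak B_\bullet(\Phi,L,\nu))\subseteq\operatorname{Supp}_R(M\otimes_RL).$$ -/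

import Mathlib

open TensorProduct CategoryTheory

universe u

noncomputable section

namespace KoszulCech

variable {R : Type u} [CommRing R] {f g : ℕ}

/-! ### Laurent polynomials, the Čech modules and their gradings -/

/-- The Laurent polynomial ring `R[T₁^{±1}, …, T_g^{±1}]`, the localization of
`S = R[T₁, …, T_g]` at `T₁ ⋯ T_g`. Exponents are vectors in `ℤ^g`. -/
abbrev Laurent (R : Type u) [CommRing R] (g : ℕ) : Type u :=
  AddMonoidAlgebra R (Fin g → ℤ)

/-- The variable `T_i`. -/
def T (R : Type u) [CommRing R] {g : ℕ} (i : Fin g) : Laurent R g :=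
  AddMonoidAlgebra.single (Pi.single i 1) 1

/-- The homogeneous component of degree `d` of the localization `S_{T_σ}`, where
`T_σ = ∏_{i ∈ σ} T_i`, viewed inside the Laurent polynomial ring: the `R`-span of the monomials
`T^a` with `a_i ≥ 0` for `i ∉ σ` and `∑ a_i = d`. For `σ = ∅` this is the component
`S_d` of `S` itself. -/
def cech (R : Type u) [CommRing R] {g : ℕ} (σ : Finset (Fin g)) (d : ℤ) :
    Submodule R (Laurent R g) :=
  AddMonoidAlgebra.supported R R {a : Fin g → ℤ | (∀ i ∉ σ, 0 ≤ a i) ∧ ∑ i, a i = d}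

/-! ### The Koszul complex of the linear forms `γ_j` -/

/-- The linear forms `γ_j = ∑_i c_{ij} T_i` attached to the matrix `Φ = (c_{ij})`. -/
def gam (Φ : Matrix (Fin g) (Fin f) R) (j : Fin f) : Laurent R g :=
  ∑ i, Φ i j • T R i

/-- The underlying module `⋀ R^f ⊗_R R[T^{±1}]` of the Koszul complex of `γ₁, …, γ_f` with
coefficients in the Laurent polynomial ring. It contains the Koszul complexes with
coefficients in all the modules `S_{T_σ}`. -/
def Amb (R : Type u) [CommRing R] (f g : ℕ) : Type u :=
  ExteriorAlgebra R (Fin f → R) ⊗[R] Laurent R g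

instance : AddCommGroup (Amb R f g) :=
  inferInstanceAs (AddCommGroup (ExteriorAlgebra R (Fin f → R) ⊗[R] Laurent R g))

instance : Module R (Amb R f g) :=
  inferInstanceAs (Module R (ExteriorAlgebra R (Fin f → R) ⊗[R] Laurent R g))

/-- The bilinear map `(x, h) ↦ x ⊗ h`. -/
def mkAmb (R : Type u) [CommRing R] (f g : ℕ) :
    ExteriorAlgebra R (Fin f → R) →ₗ[R] Laurent R g →ₗ[R] Amb R f g :=
  TensorProduct.mk R (ExteriorAlgebra R (Fin f → R)) (Laurent R g)

/-- The map `φ ⊗ ψ`. -/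
def mapAmb (φ : Module.End R (ExteriorAlgebra R (Fin f → R))) (ψ : Module.End R (Laurent R g)) :
    Module.End R (Amb R f g) :=
  TensorProduct.map φ ψ

/-- Contraction `d ⌟ _` of the exterior algebra by a linear form `d`; on `e_{j₁} ∧ ⋯ ∧ e_{j_p}` it
is `∑_k (-1)^{k-1} d(e_{j_k}) e_{j₁} ∧ ⋯ ê_{j_k} ⋯ ∧ e_{j_p}`. -/
def contr (d : Module.Dual R (Fin f → R)) : Module.End R (ExteriorAlgebra R (Fin f → R)) :=
  CliffordAlgebra.contractLeft (Q := (0 : QuadraticForm R (Fin f → R))) d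

/-- The Koszul differential `∂` of `γ₁, …, γ_f`:
`∂ (e_{j₁} ∧ ⋯ ∧ e_{j_p} ⊗ h) = ∑_k (-1)^{k-1} e_{j₁} ∧ ⋯ ê_{j_k} ⋯ ∧ e_{j_p} ⊗ γ_{j_k} h`. -/
def koszulD (Φ : Matrix (Fin g) (Fin f) R) : Module.End R (Amb R f g) :=
  ∑ j, mapAmb (contr (LinearMap.proj j)) (LinearMap.mulLeft R (gam Φ j))

/-- The exterior power `⋀^p R^f`, for an integer `p`; it is zero for `p < 0`. -/
def extPow (R : Type u) [CommRing R] (f : ℕ) (p : ℤ) :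
    Submodule R (ExteriorAlgebra R (Fin f → R)) :=
  if 0 ≤ p then ⋀[R]^p.toNat (Fin f → R) else ⊥

/-- The degree `ν` component `K_p(γ; S_{T_σ})_ν = ⋀^p R^f ⊗_R (S_{T_σ})_{ν - p}` of the `p`-th
module of the graded Koszul complex of `γ₁, …, γ_f` with coefficients in `S_{T_σ}`. -/
def K (R : Type u) [CommRing R] (f : ℕ) {g : ℕ} (σ : Finset (Fin g)) (p ν : ℤ) :
    Submodule R (Amb R f g) :=
  Submodule.map₂ (mkAmb R f g) (extPow R f p) (cech R σ (ν - p))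

/-- `K_p(γ; S)_ν`. -/
abbrev KS (R : Type u) [CommRing R] (f g : ℕ) (p ν : ℤ) : Type u :=
  ↥(K R f (∅ : Finset (Fin g)) p ν)

/-- The image of `⊕_i K_p(γ; S_{T_1 ⋯ T̂_i ⋯ T_g})_ν` in `K_p(γ; S_{T_1 ⋯ T_g})_ν`, i.e. the image
of the last Čech differential. -/
def cechBoundary (R : Type u) [CommRing R] (f g : ℕ) (p ν : ℤ) : Submodule R (Amb R f g) :=
  ⨆ i : Fin g, K R f (Finset.univ.erase i) p ν

/-- `K_p(γ; H^g_t(S))_ν = H^g_t(K_p(γ; S))_ν`, where the top local cohomology with support in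
`t = (T₁, …, T_g)` is computed by the Čech complex: it is the cokernel of the
last Čech differential. -/
abbrev KH (R : Type u) [CommRing R] (f g : ℕ) (p ν : ℤ) : Type u :=
  ↥(K R f (Finset.univ : Finset (Fin g)) p ν) ⧸
    (cechBoundary R f g p ν).submoduleOf (K R f Finset.univ p ν)

/-! ### Elementary properties of the Koszul differential -/

/-- The linear form on `R^f` given by the `i`-th row of `Φ`. -/
def row (Φ : Matrix (Fin g) (Fin f) R) (i : Fin g) : Module.Dual R (Fin f → R) :=
  ∑ j, Φ i j • LinearMap.proj j

lemma contr_contr (d : Module.Dual R (Fin f → R)) : contr d * contr d = 0 :=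
  LinearMap.ext fun x => CliffordAlgebra.contractLeft_contractLeft (Q := 0) d x

lemma contr_contr_apply (d : Module.Dual R (Fin f → R)) (x : ExteriorAlgebra R (Fin f → R)) :
    contr d (contr d x) = 0 :=
  CliffordAlgebra.contractLeft_contractLeft (Q := 0) d x

lemma contr_comm_apply (d e : Module.Dual R (Fin f → R)) (x : ExteriorAlgebra R (Fin f → R)) :
    contr d (contr e x) = -contr e (contr d x) :=
  CliffordAlgebra.contractLeft_comm (Q := 0) (d := d) (d' := e) x

lemma contr_row (Φ : Matrix (Fin g) (Fin f) R) (i : Fin g) :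
    contr (row Φ i) = ∑ j, Φ i j • contr (LinearMap.proj j) := by
  simp [contr, row, map_sum]

lemma mapAmb_mk (φ : Module.End R (ExteriorAlgebra R (Fin f → R)))
    (ψ : Module.End R (Laurent R g)) (x : ExteriorAlgebra R (Fin f → R)) (h : Laurent R g) :
    mapAmb φ ψ (mkAmb R f g x h) = mkAmb R f g (φ x) (ψ h) := rfl

lemma amb_induction {P : Amb R f g → Prop} (z : Amb R f g) (zero : P 0)
    (mk : ∀ x h, P (mkAmb R f g x h)) (add : ∀ x y, P x → P y → P (x + y)) : P z :=
  TensorProduct.induction_on z zero mk add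

lemma koszulD_mk (Φ : Matrix (Fin g) (Fin f) R) (x : ExteriorAlgebra R (Fin f → R))
    (h : Laurent R g) :
    koszulD Φ (mkAmb R f g x h) = ∑ i, mkAmb R f g (contr (row Φ i) x) (T R i * h) := by
  simp only [koszulD, LinearMap.sum_apply, mapAmb_mk, LinearMap.mulLeft_apply, gam,
    contr_row, Finset.sum_mul, map_sum, LinearMap.smul_apply, smul_mul_assoc, map_smul]
  exact Finset.sum_comm

lemma koszulD_koszulD (Φ : Matrix (Fin g) (Fin f) R) (z : Amb R f g) :
    koszulD Φ (koszulD Φ z) = 0 := by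
  induction z using amb_induction with
  | zero => simp
  | add x y hx hy => simp [hx, hy]
  | mk x h =>
    simp only [koszulD_mk, map_sum]
    set F : Fin g → Fin g → Amb R f g := fun i k =>
      mkAmb R f g (contr (row Φ k) (contr (row Φ i) x)) (T R k * (T R i * h)) with hF
    change ∑ i, ∑ k, F i k = 0
    have hanti : ∀ i k, F i k = - F k i := by
      intro i k
      simp only [hF, contr_comm_apply (row Φ k) (row Φ i), map_neg, LinearMap.neg_apply,
        mul_left_comm (T R k)]
    have hdiag : ∀ i, F i i = 0 := by
      intro i
      simp only [hF, contr_contr_apply, map_zero, LinearMap.zero_apply]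
    rw [← Finset.sum_product']
    refine Finset.sum_involution (fun a _ => (a.2, a.1)) ?_ ?_ ?_ ?_
    · rintro ⟨i, k⟩ _
      simp [hanti i k]
    · rintro ⟨i, k⟩ _ hne heq
      simp only [Prod.mk.injEq] at heq
      obtain ⟨rfl, -⟩ := heq
      exact hne (hdiag _)
    · simp
    · simp

lemma extPow_natCast (n : ℕ) : extPow R f (n : ℤ) = ⋀[R]^n (Fin f → R) := by
  simp [extPow]

lemma extPow_of_neg {p : ℤ} (hp : p < 0) : extPow R f p = ⊥ := by
  simp [extPow, not_le.mpr hp]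

lemma contr_algebraMap (d : Module.Dual R (Fin f → R)) (r : R) :
    contr d (algebraMap R _ r) = 0 :=
  CliffordAlgebra.contractLeft_algebraMap (Q := 0) d r

lemma contr_ι_mul (d : Module.Dual R (Fin f → R)) (v : Fin f → R)
    (y : ExteriorAlgebra R (Fin f → R)) :
    contr d (ExteriorAlgebra.ι R v * y) = d v • y - ExteriorAlgebra.ι R v * contr d y :=
  CliffordAlgebra.contractLeft_ι_mul (Q := 0) (d := d) v y

lemma contr_mem_exteriorPower (d : Module.Dual R (Fin f → R)) (n : ℕ) :
    ∀ x ∈ ⋀[R]^(n + 1) (Fin f → R), contr d x ∈ ⋀[R]^n (Fin f → R) := by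
  induction n with
  | zero =>
    intro x hx
    rw [ExteriorAlgebra.exteriorPower, zero_add, pow_one] at hx
    obtain ⟨v, rfl⟩ := hx
    have h := contr_ι_mul d v 1
    rw [mul_one, ← map_one (algebraMap R (ExteriorAlgebra R (Fin f → R))), contr_algebraMap,
      mul_zero, sub_zero, map_one] at h
    rw [h, ExteriorAlgebra.exteriorPower, pow_zero]
    exact Submodule.smul_mem _ _ (Submodule.one_le.1 le_rfl)
  | succ n ih =>
    intro x hx
    rw [ExteriorAlgebra.exteriorPower, pow_succ'] at hx
    induction hx using Submodule.mul_induction_on' with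
    | mem_mul_mem m hm y hy =>
      obtain ⟨v, rfl⟩ := hm
      rw [contr_ι_mul]
      refine Submodule.sub_mem _ (Submodule.smul_mem _ _ hy) ?_
      rw [ExteriorAlgebra.exteriorPower, pow_succ']
      exact Submodule.mul_mem_mul ⟨v, rfl⟩ (ih y hy)
    | add x _ y _ hx hy => rw [map_add]; exact add_mem hx hy

lemma contr_mem_extPow (d : Module.Dual R (Fin f → R)) {p : ℤ}
    {x : ExteriorAlgebra R (Fin f → R)} (hx : x ∈ extPow R f p) :
    contr d x ∈ extPow R f (p - 1) := by
  rcases lt_or_ge p 0 with hp | hp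
  · rw [extPow_of_neg hp, Submodule.mem_bot] at hx
    simp [hx]
  obtain ⟨n, rfl⟩ := Int.eq_ofNat_of_zero_le hp
  rw [extPow_natCast] at hx
  rcases n with _ | n
  · rw [ExteriorAlgebra.exteriorPower, pow_zero, Submodule.mem_one] at hx
    obtain ⟨r, rfl⟩ := hx
    rw [contr_algebraMap]
    exact zero_mem _
  · rw [show (((n + 1 : ℕ) : ℤ) - 1) = (n : ℤ) by push_cast; ring, extPow_natCast]
    exact contr_mem_exteriorPower d n _ hx

lemma coeff_T_mul (i : Fin g) (h : Laurent R g) (a : Fin g → ℤ) :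
    (T R i * h).coeff a = h.coeff (a - Pi.single i 1) := by
  rw [T, AddMonoidAlgebra.coeff_single_mul_apply, one_mul, neg_add_eq_sub]

lemma mem_cech {σ : Finset (Fin g)} {d : ℤ} {h : Laurent R g} :
    h ∈ cech R σ d ↔ ∀ a, h.coeff a ≠ 0 → (∀ i ∉ σ, 0 ≤ a i) ∧ ∑ i, a i = d := by
  rw [cech, AddMonoidAlgebra.mem_supported']
  exact forall_congr' fun a => by rw [← not_imp_comm]; rfl

lemma T_mul_mem_cech (i : Fin g) {σ : Finset (Fin g)} {d : ℤ} {h : Laurent R g}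
    (hh : h ∈ cech R σ d) : T R i * h ∈ cech R σ (d + 1) := by
  rw [mem_cech] at hh ⊢
  intro a ha
  rw [coeff_T_mul] at ha
  obtain ⟨h1, h2⟩ := hh _ ha
  constructor
  · intro k hk
    have := h1 k hk
    rw [Pi.sub_apply] at this
    have h3 : (0 : ℤ) ≤ (Pi.single i 1 : Fin g → ℤ) k := by
      rw [Pi.single_apply]; split_ifs <;> norm_num
    omega
  · simp only [Pi.sub_apply, Finset.sum_sub_distrib, Finset.sum_pi_single', Finset.mem_univ,
      if_true] at h2
    have h3 : ∑ k, (Pi.single i 1 : Fin g → ℤ) k = 1 := by simp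
    omega

lemma koszulD_mem (Φ : Matrix (Fin g) (Fin f) R) {σ : Finset (Fin g)} {p q ν : ℤ}
    (hpq : q + 1 = p) {z : Amb R f g} (hz : z ∈ K R f σ p ν) : koszulD Φ z ∈ K R f σ q ν := by
  suffices h : K R f σ p ν ≤ (K R f σ q ν).comap (koszulD Φ) from h hz
  refine Submodule.map₂_le.2 fun x hx h hh => ?_
  rw [Submodule.mem_comap, koszulD_mk]
  refine Submodule.sum_mem _ fun i _ => Submodule.apply_mem_map₂ _ ?_ ?_
  · have := contr_mem_extPow (row Φ i) hx
    rwa [show p - 1 = q by omega] at this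
  · have := T_mul_mem_cech i hh
    rwa [show ν - p + 1 = ν - q by omega] at this

/-! ### The Koszul strands -/

/-- The Koszul differential `K_p(γ; S_{T_σ})_ν → K_{p-1}(γ; S_{T_σ})_ν`. -/
def koszulK (Φ : Matrix (Fin g) (Fin f) R) (σ : Finset (Fin g)) (ν : ℤ) {p q : ℤ}
    (hpq : q + 1 = p) : K R f σ p ν →ₗ[R] K R f σ q ν :=
  (koszulD Φ).restrict fun _ hz => koszulD_mem Φ hpq hz

lemma koszulD_mem_cechBoundary (Φ : Matrix (Fin g) (Fin f) R) {p q ν : ℤ}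
    (hpq : q + 1 = p) {z : Amb R f g} (hz : z ∈ cechBoundary R f g p ν) :
    koszulD Φ z ∈ cechBoundary R f g q ν := by
  suffices h : cechBoundary R f g p ν ≤ (cechBoundary R f g q ν).comap (koszulD Φ) from h hz
  refine iSup_le fun i z hz => ?_
  exact Submodule.mem_iSup_of_mem i (koszulD_mem Φ hpq hz)

/-- The Koszul differential `K_p(γ; H^g_t(S))_ν → K_{p-1}(γ; H^g_t(S))_ν`. -/
def koszulH (Φ : Matrix (Fin g) (Fin f) R) (ν : ℤ) {p q : ℤ} (hpq : q + 1 = p) :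
    KH R f g p ν →ₗ[R] KH R f g q ν :=
  Submodule.mapQ _ _ (koszulK Φ Finset.univ ν hpq) fun _ hz =>
    koszulD_mem_cechBoundary Φ hpq hz

/-! ### Coefficients -/

/-- The coefficient of `T^a` of a Laurent polynomial. -/
def lcoeff (R : Type u) [CommRing R] {g : ℕ} (a : Fin g → ℤ) : Laurent R g →ₗ[R] R :=
  Finsupp.lapply a ∘ₗ (AddMonoidAlgebra.coeffLinearEquiv R).toLinearMap

lemma lcoeff_apply (a : Fin g → ℤ) (h : Laurent R g) : lcoeff R a h = h.coeff a := rfl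

/-- The coefficient of `T^a` of an element of `⋀ R^f ⊗ R[T^{±1}]`. -/
def coefAmb (R : Type u) [CommRing R] (f : ℕ) {g : ℕ} (a : Fin g → ℤ) :
    Amb R f g →ₗ[R] ExteriorAlgebra R (Fin f → R) :=
  TensorProduct.lift ((LinearMap.lsmul R (ExteriorAlgebra R (Fin f → R)) ∘ₗ lcoeff R a).flip)

lemma coefAmb_mk (a : Fin g → ℤ) (x : ExteriorAlgebra R (Fin f → R)) (h : Laurent R g) :
    coefAmb R f a (mkAmb R f g x h) = h.coeff a • x := rfl

lemma coefAmb_koszulD (Φ : Matrix (Fin g) (Fin f) R) (a : Fin g → ℤ) (z : Amb R f g) :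
    coefAmb R f a (koszulD Φ z) =
      ∑ i, contr (row Φ i) (coefAmb R f (a - Pi.single i 1) z) := by
  induction z using amb_induction with
  | zero => simp
  | add x y hx hy => simp [hx, hy, Finset.sum_add_distrib]
  | mk x h => simp [koszulD_mk, coefAmb_mk, coeff_T_mul]

lemma coefAmb_eq_zero {σ : Finset (Fin g)} {p ν : ℤ} {z : Amb R f g} (hz : z ∈ K R f σ p ν)
    {a : Fin g → ℤ} (ha : ¬ ((∀ i ∉ σ, 0 ≤ a i) ∧ ∑ i, a i = ν - p)) : coefAmb R f a z = 0 := by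
  suffices h : K R f σ p ν ≤ LinearMap.ker (coefAmb R f a) from h hz
  refine Submodule.map₂_le.2 fun x _ h hh => ?_
  rw [LinearMap.mem_ker, coefAmb_mk]
  by_cases h0 : h.coeff a = 0
  · rw [h0, zero_smul]
  · exact absurd (mem_cech.1 hh a h0) ha

lemma coefAmb_mem {σ : Finset (Fin g)} {p ν : ℤ} {z : Amb R f g} (hz : z ∈ K R f σ p ν)
    (a : Fin g → ℤ) : coefAmb R f a z ∈ extPow R f p := by
  suffices h : K R f σ p ν ≤ (extPow R f p).comap (coefAmb R f a) from h hz
  refine Submodule.map₂_le.2 fun x hx h _ => ?_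
  rw [Submodule.mem_comap, coefAmb_mk]
  exact Submodule.smul_mem _ _ hx

lemma single_mem_cech {σ : Finset (Fin g)} {d : ℤ} {a : Fin g → ℤ}
    (ha : (∀ i ∉ σ, 0 ≤ a i) ∧ ∑ i, a i = d) (r : R) :
    AddMonoidAlgebra.single a r ∈ cech R σ d := by
  rw [mem_cech]
  intro b hb
  by_cases hab : a = b
  · exact hab ▸ ha
  · rw [AddMonoidAlgebra.coeff_single, Finsupp.single_apply, if_neg hab] at hb
    exact absurd rfl hb

lemma laurent_ext {h k : Laurent R g} (H : ∀ a, h.coeff a = k.coeff a) : h = k :=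
  AddMonoidAlgebra.coeff_injective (Finsupp.ext H)

lemma eq_mk_of_mem {ν : ℤ} {z : Amb R f g} (hz : z ∈ K R f (∅ : Finset (Fin g)) ν ν) :
    z = mkAmb R f g (coefAmb R f 0 z) (AddMonoidAlgebra.single 0 1) := by
  suffices h : K R f (∅ : Finset (Fin g)) ν ν ≤ LinearMap.ker (LinearMap.id -
      (mkAmb R f g).flip (AddMonoidAlgebra.single 0 1) ∘ₗ coefAmb R f 0) from
    sub_eq_zero.1 (LinearMap.mem_ker.1 (h hz))
  refine Submodule.map₂_le.2 fun x _ h hh => ?_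
  have hh' : h = h.coeff 0 • AddMonoidAlgebra.single 0 1 := by
    refine laurent_ext fun a => ?_
    rw [AddMonoidAlgebra.coeff_smul, AddMonoidAlgebra.coeff_single, Finsupp.smul_apply,
      Finsupp.single_apply]
    split_ifs with h0
    · rw [h0, smul_eq_mul, mul_one]
    · by_contra hne
      rw [smul_zero] at hne
      obtain ⟨h1, h2⟩ := mem_cech.1 hh a hne
      rw [sub_self, Finset.sum_eq_zero_iff_of_nonneg (fun i _ => h1 i (Finset.notMem_empty i))]
        at h2
      exact h0 (funext fun i => (h2 i (Finset.mem_univ i)).symm)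
  rw [LinearMap.mem_ker, LinearMap.sub_apply, LinearMap.comp_apply, LinearMap.flip_apply,
    coefAmb_mk, LinearMap.id_apply, sub_eq_zero, map_smul, LinearMap.smul_apply, ← map_smul, ← hh']

/-- The vector with entries `-1` on `σ` and `0` elsewhere, i.e. the exponent of `1 / T_σ`. -/
def negInd (σ : Finset (Fin g)) : Fin g → ℤ := fun i => if i ∈ σ then -1 else 0

lemma sum_negInd (σ : Finset (Fin g)) : ∑ i, negInd σ i = -(σ.card : ℤ) := by
  simp [negInd, Finset.sum_ite_mem]

lemma mk_mem_cechBoundary {p ν : ℤ} (hp : p ≤ ν + g) {x : ExteriorAlgebra R (Fin f → R)}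
    (hx : x ∈ extPow R f p) {h : Laurent R g} (hh : h ∈ cech R Finset.univ (ν - p))
    (h0 : h.coeff (negInd Finset.univ) = 0) : mkAmb R f g x h ∈ cechBoundary R f g p ν := by
  have hs : h = ∑ a ∈ h.coeff.support, AddMonoidAlgebra.single a (h.coeff a) := by
    refine laurent_ext fun b => ?_
    rw [AddMonoidAlgebra.coeff_sum, Finsupp.finsetSum_apply]
    simp [Finsupp.single_apply]
  rw [hs, map_sum]
  refine Submodule.sum_mem _ fun a ha => ?_
  rw [Finsupp.mem_support_iff] at ha
  obtain ⟨-, h2⟩ := mem_cech.1 hh a ha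
  obtain ⟨i, hi⟩ : ∃ i, 0 ≤ a i := by
    by_contra! hcon
    have hle : ∀ i ∈ Finset.univ, a i ≤ negInd Finset.univ i := fun i _ => by
      have := hcon i
      simp only [negInd, Finset.mem_univ, if_true]
      omega
    have hsum := Finset.sum_le_sum hle
    have hcard := sum_negInd (Finset.univ : Finset (Fin g))
    rw [Finset.card_univ, Fintype.card_fin] at hcard
    have heq : ∑ i, a i = ∑ i : Fin g, negInd Finset.univ i := by omega
    have hall := (Finset.sum_eq_sum_iff_of_le hle).1 heq
    exact ha ((funext fun i => hall i (Finset.mem_univ i) : a = negInd Finset.univ) ▸ h0)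
  refine Submodule.mem_iSup_of_mem i (Submodule.apply_mem_map₂ _ hx (single_mem_cech ⟨?_, h2⟩ _))
  intro k hk
  simp only [Finset.mem_erase, Finset.mem_univ, and_true, not_not] at hk
  exact hk ▸ hi

/-- Modulo the image of the last Čech differential, an element of
`K_{ν+g}(γ; S_{T_1 ⋯ T_g})_ν` is congruent to its component along `1 / (T_1 ⋯ T_g)`. -/
lemma sub_mem_cechBoundary {p ν : ℤ} (hp : p = ν + g) {z : Amb R f g}
    (hz : z ∈ K R f Finset.univ p ν) :
    z - mkAmb R f g (coefAmb R f (negInd Finset.univ) z)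
      (AddMonoidAlgebra.single (negInd Finset.univ) 1) ∈ cechBoundary R f g p ν := by
  suffices h : K R f Finset.univ p ν ≤ (cechBoundary R f g p ν).comap (LinearMap.id -
      (mkAmb R f g).flip (AddMonoidAlgebra.single (negInd Finset.univ) 1) ∘ₗ
        coefAmb R f (negInd Finset.univ)) from h hz
  refine Submodule.map₂_le.2 fun x hx h hh => ?_
  rw [Submodule.mem_comap, LinearMap.sub_apply, LinearMap.comp_apply, LinearMap.flip_apply,
    coefAmb_mk, LinearMap.id_apply, map_smul, LinearMap.smul_apply, ← map_smul, ← map_sub]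
  refine mk_mem_cechBoundary hp.le hx (Submodule.sub_mem _ hh (Submodule.smul_mem _ _
    (single_mem_cech ⟨fun i hi => absurd (Finset.mem_univ i) hi, ?_⟩ _))) ?_
  · rw [sum_negInd, Finset.card_univ, Fintype.card_fin]
    omega
  · simp

/-- `K_p(γ; S)_ν = 0` for `p > ν`. -/
lemma K_empty_eq_bot {p ν : ℤ} (h : ν < p) : K R f (∅ : Finset (Fin g)) p ν = ⊥ := by
  refine eq_bot_iff.2 (Submodule.map₂_le.2 fun x _ k hk => ?_)
  have : k = 0 := by
    refine laurent_ext fun a => ?_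
    by_contra hne
    obtain ⟨h1, h2⟩ := mem_cech.1 hk a hne
    have : 0 ≤ ∑ i, a i := Finset.sum_nonneg fun i _ => h1 i (Finset.notMem_empty i)
    omega
  rw [this, map_zero]
  exact zero_mem _

/-- `K_p(γ; H^g_t(S))_ν = 0` for `p < ν + g`. -/
lemma KH_eq_zero {p ν : ℤ} (h : p < ν + g) (x : KH R f g p ν) : x = 0 := by
  obtain ⟨⟨z, hz⟩, rfl⟩ := Submodule.Quotient.mk_surjective _ x
  rw [Submodule.Quotient.mk_eq_zero]
  change z ∈ cechBoundary R f g p ν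
  suffices hle : K R f Finset.univ p ν ≤ cechBoundary R f g p ν from hle hz
  refine Submodule.map₂_le.2 fun x hx k hk => mk_mem_cechBoundary h.le hx hk ?_
  by_contra hne
  have h2 := (mem_cech.1 hk _ hne).2
  rw [sum_negInd, Finset.card_univ, Fintype.card_fin] at h2
  omega

/-! ### The total complex of the Koszul–Čech double complex and the map `τ_ν` -/

/-- `z = (z_σ)_σ` is a cycle of total homological degree `n` in the internal degree `ν` part of the
total complex of the double complex `K_p(γ; S) ⊗_S C^q_t`, where `C^•_t` is the Čech complex of
`T₁, …, T_g`, with `C^q_t = ⊕_{|σ| = q} S_{T_σ}` and Čech differential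
`(d z)_σ = ∑_{i ∈ σ} (-1)^{#{k ∈ σ | k < i}} z_{σ ∖ i}`. In total degree `n = p - q` the component
`z_σ` lies in `K_{n+|σ|}(γ; S_{T_σ})_ν`, and the total differential is `(-1)^q ∂ + d`. -/
structure IsTotalCycle (Φ : Matrix (Fin g) (Fin f) R) (n ν : ℤ)
    (z : Finset (Fin g) → Amb R f g) : Prop where
  mem : ∀ σ, z σ ∈ K R f σ (n + σ.card) ν
  cycle : ∀ σ : Finset (Fin g), (-1 : ℤ) ^ σ.card • koszulD Φ (z σ) +
    ∑ i ∈ σ, (-1 : ℤ) ^ (σ.filter (· < i)).card • z (σ.erase i) = 0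

/-- The ordered composite of the contractions by the rows of `Φ` with index in `s` and `< k`. -/
def Q (Φ : Matrix (Fin g) (Fin f) R) (s : Finset (Fin g)) :
    ℕ → Module.End R (ExteriorAlgebra R (Fin f → R))
  | 0 => 1
  | k + 1 => Q Φ s k * (if h : k < g then (if ⟨k, h⟩ ∈ s then contr (row Φ ⟨k, h⟩) else 1) else 1)

lemma Q_succ_of_mem (Φ : Matrix (Fin g) (Fin f) R) {s : Finset (Fin g)} {i : Fin g} (hi : i ∈ s) :
    Q Φ s (i + 1) = Q Φ s i * contr (row Φ i) := by
  simp [Q, hi]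

lemma contr_comm (d e : Module.Dual R (Fin f → R)) : contr d * contr e = -(contr e * contr d) :=
  LinearMap.ext fun x => contr_comm_apply d e x

lemma end_mul_neg (a b : Module.End R (ExteriorAlgebra R (Fin f → R))) : a * -b = -(a * b) :=
  LinearMap.ext fun x => map_neg a (b x)

lemma Q_mul_contr_eq_zero (Φ : Matrix (Fin g) (Fin f) R) {s : Finset (Fin g)} {i : Fin g}
    (hi : i ∈ s) {k : ℕ} (hk : (i : ℕ) < k) : Q Φ s k * contr (row Φ i) = 0 := by
  induction k with
  | zero => omega
  | succ k ih =>
    rcases eq_or_ne (i : ℕ) k with rfl | hne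
    · rw [Q_succ_of_mem Φ hi, mul_assoc, contr_contr, mul_zero]
    · have ih' := ih (by omega)
      simp only [Q]
      split_ifs
      · rw [mul_assoc, contr_comm, end_mul_neg, ← mul_assoc, ih', zero_mul, neg_zero]
      · rw [mul_one, ih']
      · rw [mul_one, ih']

lemma card_filter_succ_of_mem {s : Finset (Fin g)} {k : ℕ} (h : k < g) (hk : ⟨k, h⟩ ∈ s) :
    (s.filter (·.val < k + 1)).card = (s.filter (·.val < k)).card + 1 := by
  have : s.filter (·.val < k + 1) = insert ⟨k, h⟩ (s.filter (·.val < k)) := by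
    ext j
    simp only [Finset.mem_filter, Finset.mem_insert, Fin.ext_iff]
    constructor
    · rintro ⟨h1, h2⟩
      by_cases h3 : j.val = k
      · exact Or.inl h3
      · exact Or.inr ⟨h1, by omega⟩
    · rintro (h1 | ⟨h1, h2⟩)
      · exact ⟨(Fin.ext h1 : j = ⟨k, h⟩) ▸ hk, by omega⟩
      · exact ⟨h1, by omega⟩
  rw [this, Finset.card_insert_of_notMem]
  simp

lemma card_filter_succ_of_notMem {s : Finset (Fin g)} {k : ℕ}
    (hk : ∀ h : k < g, (⟨k, h⟩ : Fin g) ∉ s) :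
    (s.filter (·.val < k + 1)).card = (s.filter (·.val < k)).card := by
  congr 1
  ext j
  simp only [Finset.mem_filter, and_congr_right_iff]
  intro hj
  constructor
  · intro h
    rcases Nat.lt_succ_iff_lt_or_eq.1 h with h | h
    · exact h
    · subst h
      exact absurd hj (hk j.isLt)
  · intro h; omega

lemma contr_mul_Q (Φ : Matrix (Fin g) (Fin f) R) (s : Finset (Fin g)) (i : Fin g) (k : ℕ) :
    contr (row Φ i) * Q Φ s k =
      (-1 : ℤ) ^ (s.filter (·.val < k)).card • (Q Φ s k * contr (row Φ i)) := by
  induction k with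
  | zero => simp [Q]
  | succ k ih =>
    by_cases hk : ∃ h : k < g, (⟨k, h⟩ : Fin g) ∈ s
    · obtain ⟨h, hk⟩ := hk
      have hQ : Q Φ s (k + 1) = Q Φ s k * contr (row Φ ⟨k, h⟩) := by simp [Q, h, hk]
      rw [card_filter_succ_of_mem h hk, hQ, ← mul_assoc, ih, smul_mul_assoc, mul_assoc,
        contr_comm, end_mul_neg, mul_assoc, pow_succ, mul_smul, neg_one_smul]
    · push Not at hk
      have hQ : Q Φ s (k + 1) = Q Φ s k := by
        simp only [Q]
        split_ifs with h1 h2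
        · exact absurd h2 (hk h1)
        · rw [mul_one]
        · rw [mul_one]
      rw [card_filter_succ_of_notMem hk, hQ, ih]

lemma Q_insert_of_le (Φ : Matrix (Fin g) (Fin f) R) (s : Finset (Fin g)) (i : Fin g) {k : ℕ}
    (hk : k ≤ i) : Q Φ (insert i s) k = Q Φ s k := by
  induction k with
  | zero => rfl
  | succ k ih =>
    simp only [Q]
    rw [ih (by omega)]
    have : ∀ h : k < g, (⟨k, h⟩ : Fin g) ≠ i := fun h he => by
      rw [Fin.ext_iff] at he
      simp only at he
      omega
    congr 1
    refine dite_congr rfl (fun h => ?_) fun _ => rfl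
    simp [this h]

lemma contr_mul_Q_insert (Φ : Matrix (Fin g) (Fin f) R) {s : Finset (Fin g)} {i : Fin g}
    (hi : i ∉ s) {k : ℕ} (hk : (i : ℕ) < k) :
    contr (row Φ i) * Q Φ s k =
      (-1 : ℤ) ^ (s.filter (· < i)).card • Q Φ (insert i s) k := by
  induction k with
  | zero => omega
  | succ k ih =>
    rcases eq_or_ne (i : ℕ) k with rfl | hne
    · rw [Q_succ_of_mem Φ (Finset.mem_insert_self i s), Q_insert_of_le Φ s i le_rfl]
      have hQ : Q Φ s (i + 1) = Q Φ s i := by simp [Q, hi]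
      rw [hQ, contr_mul_Q]
      rfl
    · have ih' := ih (by omega)
      have hmem : ∀ h : k < g, ((⟨k, h⟩ : Fin g) ∈ insert i s ↔ (⟨k, h⟩ : Fin g) ∈ s) := by
        intro h
        rw [Finset.mem_insert, or_iff_right]
        intro he
        rw [Fin.ext_iff] at he
        exact hne he.symm
      simp only [Q]
      rw [← mul_assoc, ih', smul_mul_assoc]
      congr 2
      refine dite_congr rfl (fun h => ?_) fun _ => rfl
      simp [hmem h]

lemma contr_mul_Q_of_mem (Φ : Matrix (Fin g) (Fin f) R) {s : Finset (Fin g)} {i : Fin g}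
    (hi : i ∈ s) : contr (row Φ i) * Q Φ s g = 0 := by
  rw [contr_mul_Q, Q_mul_contr_eq_zero Φ hi i.isLt, smul_zero]

lemma Q_mem_extPow (Φ : Matrix (Fin g) (Fin f) R) (s : Finset (Fin g)) (k : ℕ) {p : ℤ}
    {x : ExteriorAlgebra R (Fin f → R)} (hx : x ∈ extPow R f p) :
    Q Φ s k x ∈ extPow R f (p - (s.filter (·.val < k)).card) := by
  induction k generalizing p x with
  | zero => simpa [Q] using hx
  | succ k ih =>
    by_cases hk : ∃ h : k < g, (⟨k, h⟩ : Fin g) ∈ s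
    · obtain ⟨h, hk⟩ := hk
      have hQ : Q Φ s (k + 1) = Q Φ s k * contr (row Φ ⟨k, h⟩) := by simp [Q, h, hk]
      have := ih (contr_mem_extPow (row Φ ⟨k, h⟩) hx)
      rw [card_filter_succ_of_mem h hk, hQ, Module.End.mul_apply]
      convert this using 2
      push_cast
      ring
    · push Not at hk
      have hQ : Q Φ s (k + 1) = Q Φ s k := by
        simp only [Q]
        split_ifs with h1 h2
        · exact absurd h2 (hk h1)
        · rw [mul_one]
        · rw [mul_one]
      rw [card_filter_succ_of_notMem hk, hQ]
      exact ih hx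

lemma Q_mem_extPow' (Φ : Matrix (Fin g) (Fin f) R) (s : Finset (Fin g)) {p : ℤ}
    {x : ExteriorAlgebra R (Fin f → R)} (hx : x ∈ extPow R f p) :
    Q Φ s g x ∈ extPow R f (p - s.card) := by
  have := Q_mem_extPow Φ s g hx
  rwa [Finset.filter_true_of_mem fun i _ => i.isLt] at this

lemma coefAmb_chain {Φ : Matrix (Fin g) (Fin f) R} {n ν : ℤ} {z : Finset (Fin g) → Amb R f g}
    (hz : IsTotalCycle Φ n ν z) {k : ℕ} (hk : k ≤ g) :
    coefAmb R f 0 (z ∅) = Q Φ Finset.univ k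
      (coefAmb R f (negInd (Finset.univ.filter (·.val < k))) (z (Finset.univ.filter (·.val < k)))) := by
  induction k with
  | zero =>
    have h1 : (Finset.univ.filter fun i : Fin g => i.val < 0) = ∅ := by simp
    have h2 : negInd (∅ : Finset (Fin g)) = 0 := by ext i; simp [negInd]
    rw [h1, h2]
    rfl
  | succ k ih =>
    rw [ih (by omega)]
    set j : Fin g := ⟨k, by omega⟩ with hj
    set s : Finset (Fin g) := Finset.univ.filter (·.val < k) with hs
    set t : Finset (Fin g) := Finset.univ.filter (·.val < k + 1) with ht
    have hjt : j ∈ t := by simp [ht, hj]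
    have hts : t.erase j = s := by
      ext i
      simp only [ht, hs, Finset.mem_erase, Finset.mem_filter, Finset.mem_univ, true_and, ne_eq,
        Fin.ext_iff, hj]
      omega
    have hcard : (t.filter (· < j)).card + 1 = t.card := by
      rw [← Finset.card_erase_add_one hjt, hts]
      congr 2
      ext i
      simp only [ht, hs, Finset.mem_filter, Finset.mem_univ, true_and, Fin.lt_def, hj]
      omega
    have hcyc := congrArg (coefAmb R f (negInd s)) (hz.cycle t)
    rw [map_add, map_sum, map_zero, ← Finset.add_sum_erase _ _ hjt, map_zsmul, map_zsmul, hts,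
      Finset.sum_eq_zero, add_zero, ← hcard, pow_succ, mul_neg_one, neg_smul] at hcyc
    · have hcyc' : coefAmb R f (negInd s) (z s) =
          coefAmb R f (negInd s) (koszulD Φ (z t)) := by
        rw [neg_add_eq_zero] at hcyc
        have h3 := congrArg (fun w => (-1 : ℤ) ^ (t.filter (· < j)).card • w) hcyc
        simp only [smul_smul, ← mul_pow, mul_neg, mul_one, neg_neg, one_pow, one_smul] at h3
        exact h3.symm
      have hQ : Q Φ Finset.univ (k + 1) = Q Φ Finset.univ k * contr (row Φ j) :=
        Q_succ_of_mem Φ (Finset.mem_univ j)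
      rw [hcyc', coefAmb_koszulD, map_sum, Finset.sum_eq_single j]
      · have h4 : negInd s - Pi.single j 1 = negInd t := by
          ext i
          by_cases hi : i = j
          · subst hi
            simp [negInd, hs, ht, hj]
          · have hi' : i.val ≠ k := fun h => hi (Fin.ext h)
            have : i.val < k ↔ i.val < k + 1 := by omega
            simp [negInd, hs, ht, hi, this]
        rw [h4, hQ]
        rfl
      · intro i _ hij
        by_cases hik : i.val < k
        · rw [← Module.End.mul_apply, Q_mul_contr_eq_zero Φ (Finset.mem_univ i) hik,
            LinearMap.zero_apply]
        · rw [coefAmb_eq_zero (hz.mem t), map_zero, map_zero]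
          rintro ⟨h5, -⟩
          have hij' : i.val ≠ k := fun h => hij (Fin.ext h)
          have h6 := h5 i (by simp [ht]; omega)
          simp [negInd, hs, hik] at h6
      · intro h; exact absurd (Finset.mem_univ _) h
    · intro i hi
      have hit : i ∈ s := hi
      rw [map_zsmul, coefAmb_eq_zero (hz.mem _), smul_zero]
      rintro ⟨h5, -⟩
      have h6 := h5 i (Finset.notMem_erase i t)
      simp [negInd, hit] at h6

lemma negInd_univ_filter :
    (Finset.univ.filter fun i : Fin g => i.val < g) = Finset.univ :=
  Finset.filter_true_of_mem fun i _ => i.isLt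

/-- The map `x ⊗ h ↦ (φ₁ ⌟ ⋯ φ_g ⌟ x) ⊗ h_{(-1, …, -1)}`, with `φ_i` the rows of `Φ`. -/
def tauAmb (Φ : Matrix (Fin g) (Fin f) R) : Module.End R (Amb R f g) :=
  (mkAmb R f g).flip (AddMonoidAlgebra.single 0 1) ∘ₗ Q Φ Finset.univ g ∘ₗ
    coefAmb R f (negInd Finset.univ)

lemma tauAmb_apply (Φ : Matrix (Fin g) (Fin f) R) (z : Amb R f g) :
    tauAmb Φ z = mkAmb R f g (Q Φ Finset.univ g (coefAmb R f (negInd Finset.univ) z))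
      (AddMonoidAlgebra.single 0 1) := rfl

/-- The bottom component of a total cycle is determined by its top component. -/
lemma tauAmb_of_isTotalCycle {Φ : Matrix (Fin g) (Fin f) R} {ν : ℤ}
    {z : Finset (Fin g) → Amb R f g} (hz : IsTotalCycle Φ ν ν z) :
    tauAmb Φ (z Finset.univ) = z ∅ := by
  have h0 := hz.mem ∅
  rw [Finset.card_empty, Nat.cast_zero, add_zero] at h0
  have h1 := coefAmb_chain hz le_rfl
  rw [negInd_univ_filter] at h1
  rw [tauAmb_apply, ← h1, ← eq_mk_of_mem h0]

lemma tauAmb_mem (Φ : Matrix (Fin g) (Fin f) R) {p ν : ℤ} (hp : p = ν + g) {z : Amb R f g}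
    (hz : z ∈ K R f Finset.univ p ν) : tauAmb Φ z ∈ K R f (∅ : Finset (Fin g)) ν ν := by
  rw [tauAmb_apply]
  refine Submodule.apply_mem_map₂ _ ?_ (single_mem_cech ⟨fun _ _ => le_rfl, by simp⟩ _)
  have := Q_mem_extPow' Φ Finset.univ (coefAmb_mem hz (negInd Finset.univ))
  rw [Finset.card_univ, Fintype.card_fin] at this
  rwa [show p - (g : ℤ) = ν by omega] at this

lemma tauAmb_cechBoundary (Φ : Matrix (Fin g) (Fin f) R) {p ν : ℤ} {z : Amb R f g}
    (hz : z ∈ cechBoundary R f g p ν) : tauAmb Φ z = 0 := by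
  suffices h : cechBoundary R f g p ν ≤ LinearMap.ker (tauAmb Φ) from h hz
  refine iSup_le fun i w hw => ?_
  rw [LinearMap.mem_ker, tauAmb_apply, coefAmb_eq_zero hw, map_zero, map_zero,
    LinearMap.zero_apply]
  rintro ⟨h5, -⟩
  have h6 := h5 i (Finset.notMem_erase i _)
  simp [negInd] at h6

/-- The signs in the explicit total cycles. -/
def eps (s : Finset (Fin g)) : ℤ := (-1) ^ (∑ i ∈ s, i.val + s.card.choose 2)

lemma eps_mul_self (s : Finset (Fin g)) : eps s * eps s = 1 := by
  rw [eps, ← mul_pow]; norm_num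

lemma eps_erase {s : Finset (Fin g)} {i : Fin g} (hi : i ∈ s) :
    eps s = (-1) ^ (i.val + (s.card - 1)) * eps (s.erase i) := by
  obtain ⟨m, hm⟩ : ∃ m, s.card = m + 1 := ⟨s.card - 1, by have := Finset.card_pos.2 ⟨i, hi⟩; omega⟩
  rw [eps, eps, ← pow_add, Finset.card_erase_of_mem hi, hm, ← Finset.add_sum_erase _ _ hi,
    Nat.choose_succ_succ' m 1, Nat.choose_one_right, Nat.add_sub_cancel]
  congr 1
  ring

lemma T_mul_single_negInd {s : Finset (Fin g)} {i : Fin g} (hi : i ∈ s) :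
    T R i * AddMonoidAlgebra.single (negInd s) 1 =
      AddMonoidAlgebra.single (negInd (s.erase i)) 1 := by
  rw [T, AddMonoidAlgebra.single_mul_single, one_mul]
  congr 1
  ext k
  by_cases hk : k = i
  · subst hk; simp [negInd, hi]
  · simp [negInd, hk]

lemma card_filter_lt_add (s : Finset (Fin g)) (i : Fin g) :
    (s.filter (· < i)).card + (sᶜ.filter (· < i)).card = i.val := by
  rw [← Finset.card_union_of_disjoint, ← Finset.filter_union, Finset.union_compl]
  · rw [show Finset.univ.filter (· < i) = Finset.Iio i by ext k; simp, Fin.card_Iio]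
  · exact Finset.disjoint_filter_filter disjoint_compl_right

/-- Every `y ⊗ 1 / (T_1 ⋯ T_g)` is, up to sign, the top component of a total cycle. -/
lemma isTotalCycle_explicit (Φ : Matrix (Fin g) (Fin f) R) {p ν : ℤ} (hp : p = ν + g)
    {y : ExteriorAlgebra R (Fin f → R)} (hy : y ∈ extPow R f p) :
    IsTotalCycle Φ ν ν fun s => eps s • mkAmb R f g (Q Φ sᶜ g y)
      (AddMonoidAlgebra.single (negInd s) 1) where
  mem s := by
    refine zsmul_mem (Submodule.apply_mem_map₂ _ ?_ (single_mem_cech ⟨fun i hi => ?_, ?_⟩ _)) _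
    · have := Q_mem_extPow' Φ sᶜ hy
      have hc := Finset.card_add_card_compl s
      rw [Fintype.card_fin] at hc
      rwa [show p - (sᶜ.card : ℤ) = ν + s.card by omega] at this
    · simp [negInd, hi]
    · rw [sum_negInd]; ring
  cycle s := by
    rw [map_zsmul, koszulD_mk, ← Finset.sum_subset (Finset.subset_univ s), Finset.smul_sum,
      Finset.smul_sum, ← Finset.sum_add_distrib]
    · refine Finset.sum_eq_zero fun i hi => ?_
      have h1 := congrArg (fun e => e y)
        (contr_mul_Q_insert Φ (s := sᶜ) (i := i) (by simpa using hi) i.isLt)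
      simp only [Module.End.mul_apply, LinearMap.smul_apply] at h1
      have h2 : insert i sᶜ = (s.erase i)ᶜ := by rw [Finset.compl_erase]
      rw [h1, h2, T_mul_single_negInd hi, map_zsmul, LinearMap.smul_apply, smul_smul, smul_smul,
        smul_smul, ← add_smul, eps_erase hi]
      have h3 := card_filter_lt_add s i
      obtain ⟨m, hm⟩ : ∃ m, s.card = m + 1 :=
        ⟨s.card - 1, by have := Finset.card_pos.2 ⟨i, hi⟩; omega⟩
      rw [← h3, hm, Nat.add_sub_cancel]
      generalize (s.filter (· < i)).card = a
      generalize (sᶜ.filter (· < i)).card = b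
      have h4 : ((-1 : ℤ) ^ m) * (-1) ^ m = 1 := by rw [← mul_pow]; norm_num
      have h5 : ((-1 : ℤ) ^ b) * (-1) ^ b = 1 := by rw [← mul_pow]; norm_num
      have h6 : (-1 : ℤ) ^ (m + 1) * ((-1) ^ (a + b + m) * eps (s.erase i)) * (-1) ^ b +
          (-1) ^ a * eps (s.erase i) = 0 := by
        rw [pow_succ, pow_add, pow_add]
        linear_combination (-(-1 : ℤ) ^ a * eps (s.erase i) * ((-1) ^ b * (-1) ^ b)) * h4 -
          ((-1 : ℤ) ^ a * eps (s.erase i)) * h5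
      rw [show (-1 : ℤ) ^ (m + 1) * ((-1) ^ (a + b + m) * eps (s.erase i)) * (-1) ^ b +
          (-1) ^ a * eps (s.erase i) = 0 from h6, zero_smul]
    · intro i _ hi
      have h1 := congrArg (fun e => e y) (contr_mul_Q_of_mem Φ (s := sᶜ) (i := i) (by simpa using hi))
      simp only [Module.End.mul_apply, LinearMap.zero_apply] at h1
      rw [h1, map_zero, LinearMap.zero_apply]

/-- The defining property of the map `τ_ν : K_{ν+g}(γ; H^g_t(S))_ν → K_ν(γ; S)_ν`. Both edges of the
spectral sequences of the double complex are read off from the total complex: the isomorphism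
`H_ν(Tot)_ν ≅ coker δ_ν` sends the class of a total cycle `z` to the class of its component in
`K_{ν+g} ⊗ C^g_t`, and the edge map `H_ν(Tot)_ν → (^∞E^{-ν,0}_hor)_ν ⊆ H_ν(γ; S)_ν ⊆ K_ν(γ; S)_ν` sends
it to the component of `z` in `K_ν ⊗ C^0_t`. So `τ_ν` is the map that sends the class of the top
component of any total cycle to its bottom component. -/
def IsTransgression (Φ : Matrix (Fin g) (Fin f) R) {p n ν : ℤ}
    (τ : KH R f g p ν →ₗ[R] KS R f g n ν) : Prop :=
  ∀ z : Finset (Fin g) → Amb R f g, IsTotalCycle Φ ν ν z →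
    ∀ hz : z Finset.univ ∈ K R f Finset.univ p ν,
      (τ (Submodule.Quotient.mk ⟨z Finset.univ, hz⟩) : Amb R f g) = z ∅

/-- `τ_ν` exists and is unique; it is induced by contraction with all the rows of `Φ`. -/
theorem exists_transgression (Φ : Matrix (Fin g) (Fin f) R) {p n ν : ℤ} (hp : p = ν + g)
    (hn : n = ν) : ∃ τ : KH R f g p ν →ₗ[R] KS R f g n ν, IsTransgression Φ τ ∧
      (∀ x : K R f (Finset.univ : Finset (Fin g)) p ν,
        (τ (Submodule.Quotient.mk x) : Amb R f g) = tauAmb Φ x) ∧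
      ∀ τ' : KH R f g p ν →ₗ[R] KS R f g n ν, IsTransgression Φ τ' → τ' = τ := by
  subst hn
  let τ : KH R f g p n →ₗ[R] KS R f g n n :=
    Submodule.liftQ _ ((tauAmb Φ).restrict fun z hz => tauAmb_mem Φ hp hz) fun x hx => by
      rw [LinearMap.mem_ker]
      exact Subtype.ext (tauAmb_cechBoundary Φ hx)
  have hτ : ∀ x : K R f (Finset.univ : Finset (Fin g)) p n,
      (τ (Submodule.Quotient.mk x) : Amb R f g) = tauAmb Φ x := fun x => rfl
  have hτ' : IsTransgression Φ τ := fun z hz hz' => by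
    rw [hτ]
    exact tauAmb_of_isTotalCycle hz
  refine ⟨τ, hτ', hτ, fun σ hσ => LinearMap.ext fun x => ?_⟩
  obtain ⟨⟨x, hx⟩, rfl⟩ := Submodule.Quotient.mk_surjective _ x
  set y := coefAmb R f (negInd Finset.univ) x with hy
  have hyp : y ∈ extPow R f p := coefAmb_mem hx _
  have hcyc := isTotalCycle_explicit Φ hp hyp
  set z : Finset (Fin g) → Amb R f g := fun s => eps s • mkAmb R f g (Q Φ sᶜ g y)
    (AddMonoidAlgebra.single (negInd s) 1) with hzdef
  have hmem : z Finset.univ ∈ K R f Finset.univ p n := by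
    have := hcyc.mem Finset.univ
    rwa [Finset.card_univ, Fintype.card_fin, ← hp] at this
  have hQ : Q Φ (∅ : Finset (Fin g)) g = 1 := by
    have : ∀ k, Q Φ (∅ : Finset (Fin g)) k = 1 := fun k => by
      induction k with
      | zero => rfl
      | succ k ih => simp [Q, ih]
    exact this g
  have hclass : (Submodule.Quotient.mk ⟨x, hx⟩ : KH R f g p n) =
      eps (Finset.univ : Finset (Fin g)) • Submodule.Quotient.mk ⟨z Finset.univ, hmem⟩ := by
    rw [← Submodule.Quotient.mk_smul, Submodule.Quotient.eq]
    change x - eps Finset.univ • z Finset.univ ∈ cechBoundary R f g p n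
    have h := sub_mem_cechBoundary hp hx
    simp only [hzdef, Finset.compl_univ, hQ, Module.End.one_apply, smul_smul, eps_mul_self,
      one_smul]
    exact h
  rw [hclass, map_zsmul, map_zsmul]
  congr 1
  exact Subtype.ext ((hσ z hcyc hmem).trans (hτ' z hcyc hmem).symm)

/-- The map `τ_ν : K_{ν+g}(γ; H^g_t(S))_ν → K_ν(γ; S)_ν`. -/
def transgression (Φ : Matrix (Fin g) (Fin f) R) {p n ν : ℤ} (hp : p = ν + g) (hn : n = ν) :
    KH R f g p ν →ₗ[R] KS R f g n ν :=
  (exists_transgression Φ hp hn).choose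

theorem transgression_isTransgression (Φ : Matrix (Fin g) (Fin f) R) {p n ν : ℤ}
    (hp : p = ν + g) (hn : n = ν) : IsTransgression Φ (transgression Φ hp hn) :=
  (exists_transgression Φ hp hn).choose_spec.1

theorem transgression_mk (Φ : Matrix (Fin g) (Fin f) R) {p n ν : ℤ}
    (hp : p = ν + g) (hn : n = ν) (x : K R f (Finset.univ : Finset (Fin g)) p ν) :
    (transgression Φ hp hn (Submodule.Quotient.mk x) : Amb R f g) = tauAmb Φ x :=
  (exists_transgression Φ hp hn).choose_spec.2.1 x

/-- The map `τ_ν` is characterized by its defining property. -/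
theorem eq_transgression (Φ : Matrix (Fin g) (Fin f) R) {p n ν : ℤ}
    (hp : p = ν + g) (hn : n = ν) {τ : KH R f g p ν →ₗ[R] KS R f g n ν}
    (hτ : IsTransgression Φ τ) : τ = transgression Φ hp hn :=
  (exists_transgression Φ hp hn).choose_spec.2.2 τ hτ

/-! ### The complexes `𝔅(Φ, ν)` -/

lemma koszulK_comp (Φ : Matrix (Fin g) (Fin f) R) (s : Finset (Fin g)) (ν : ℤ) {p q r : ℤ}
    (hpq : q + 1 = p) (hqr : r + 1 = q) :
    koszulK Φ s ν hqr ∘ₗ koszulK Φ s ν hpq = 0 :=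
  LinearMap.ext fun x => Subtype.ext (koszulD_koszulD Φ x)

lemma koszulH_comp (Φ : Matrix (Fin g) (Fin f) R) (ν : ℤ) {p q r : ℤ}
    (hpq : q + 1 = p) (hqr : r + 1 = q) :
    koszulH Φ ν hqr ∘ₗ koszulH Φ ν hpq = 0 := by
  refine LinearMap.ext fun x => ?_
  obtain ⟨x, rfl⟩ := Submodule.Quotient.mk_surjective _ x
  change Submodule.Quotient.mk (koszulK Φ Finset.univ ν hqr (koszulK Φ Finset.univ ν hpq x)) = 0
  rw [← LinearMap.comp_apply, koszulK_comp, LinearMap.zero_apply, Submodule.Quotient.mk_zero]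

/-- `∂_ν ∘ τ_ν = 0`. -/
lemma koszulK_transgression (Φ : Matrix (Fin g) (Fin f) R) {p n m ν : ℤ} (hp : p = ν + g)
    (hn : n = ν) (hm : m + 1 = n) : koszulK Φ ∅ ν hm ∘ₗ transgression Φ hp hn = 0 := by
  refine LinearMap.ext fun x => Subtype.ext ?_
  obtain ⟨x, rfl⟩ := Submodule.Quotient.mk_surjective _ x
  change koszulD Φ (transgression Φ hp hn (Submodule.Quotient.mk x) : Amb R f g) = 0
  rw [transgression_mk, tauAmb_apply, koszulD_mk]
  refine Finset.sum_eq_zero fun i _ => ?_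
  rw [← Module.End.mul_apply, contr_mul_Q_of_mem Φ (Finset.mem_univ i), LinearMap.zero_apply,
    map_zero, LinearMap.zero_apply]

/-- `τ_ν ∘ δ_ν = 0`. -/
lemma transgression_koszulH (Φ : Matrix (Fin g) (Fin f) R) {p q n ν : ℤ} (hp : p = ν + g)
    (hn : n = ν) (hq : p + 1 = q) : transgression Φ hp hn ∘ₗ koszulH Φ ν hq = 0 := by
  refine LinearMap.ext fun x => Subtype.ext ?_
  obtain ⟨x, rfl⟩ := Submodule.Quotient.mk_surjective _ x
  change (transgression Φ hp hn (Submodule.Quotient.mk (koszulK Φ Finset.univ ν hq x)) :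
    Amb R f g) = 0
  rw [transgression_mk, tauAmb_apply]
  change mkAmb R f g (Q Φ Finset.univ g (coefAmb R f (negInd Finset.univ) (koszulD Φ x))) _ = 0
  rw [coefAmb_koszulD, map_sum, Finset.sum_eq_zero, map_zero, LinearMap.zero_apply]
  intro i _
  rw [← Module.End.mul_apply, Q_mul_contr_eq_zero Φ (Finset.mem_univ i) i.isLt,
    LinearMap.zero_apply]

/-- The strand `K_•(γ; S)_ν`, with `K_i(γ; S)_ν` in homological degree `i`. -/
def complexS (Φ : Matrix (Fin g) (Fin f) R) (ν : ℤ) : ChainComplex (ModuleCat.{u} R) ℤ :=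
  ChainComplex.of (fun i => ModuleCat.of R (KS R f g i ν))
    (fun _ => ModuleCat.ofHom (koszulK Φ ∅ ν rfl)) fun _ => by
      rw [← ModuleCat.ofHom_comp, koszulK_comp]
      rfl

/-- The strand `K_•(γ; H^g_t(S))_ν`, with `K_{g+ν+i}(γ; H^g_t(S))_ν` in homological degree `i`. -/
def complexH (Φ : Matrix (Fin g) (Fin f) R) (ν : ℤ) : ChainComplex (ModuleCat.{u} R) ℤ :=
  ChainComplex.of (fun i => ModuleCat.of R (KH R f g (g + ν + i) ν))
    (fun i => ModuleCat.ofHom (koszulH Φ ν (by ring : g + ν + i + 1 = g + ν + (i + 1))))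
    fun _ => by
      rw [← ModuleCat.ofHom_comp, koszulH_comp]
      rfl

/-- The map from the second to the first summand in homological degree `i + 1` of the spliced
complex: it is `τ_ν` for `i = ν`, and zero otherwise. -/
def spliceMap (Φ : Matrix (Fin g) (Fin f) R) (ν i : ℤ) :
    KH R f g (i + 1 - 1 + g) ν →ₗ[R] KS R f g i ν :=
  if h : i = ν then transgression Φ (by rw [h]; ring) h else 0

lemma koszulK_spliceMap (Φ : Matrix (Fin g) (Fin f) R) (ν i : ℤ) :
    koszulK Φ ∅ ν rfl ∘ₗ spliceMap Φ ν (i + 1) = 0 := by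
  unfold spliceMap
  split_ifs with h
  · exact koszulK_transgression Φ _ h rfl
  · rw [LinearMap.comp_zero]

lemma spliceMap_koszulH (Φ : Matrix (Fin g) (Fin f) R) (ν i : ℤ) {q : ℤ}
    (hq : i + 1 - 1 + g + 1 = q) : spliceMap Φ ν i ∘ₗ koszulH Φ ν hq = 0 := by
  unfold spliceMap
  split_ifs with h
  · exact transgression_koszulH Φ _ h hq
  · rw [LinearMap.zero_comp]

/-- The differential of the spliced complex. -/
def spliceD (Φ : Matrix (Fin g) (Fin f) R) (ν i : ℤ) :
    (KS R f g (i + 1) ν × KH R f g (i + 1 - 1 + g) ν) →ₗ[R]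
      (KS R f g i ν × KH R f g (i - 1 + g) ν) :=
  LinearMap.prod
    ((koszulK Φ ∅ ν rfl).coprod (spliceMap Φ ν i))
    (koszulH Φ ν (by ring : i - 1 + g + 1 = i + 1 - 1 + g) ∘ₗ LinearMap.snd R _ _)

lemma spliceD_comp (Φ : Matrix (Fin g) (Fin f) R) (ν i : ℤ) :
    spliceD Φ ν i ∘ₗ spliceD Φ ν (i + 1) = 0 := by
  refine LinearMap.ext fun ⟨x, y⟩ => Prod.ext ?_ ?_
  · have h1 := LinearMap.congr_fun
      (koszulK_comp Φ ∅ ν (rfl : i + 1 + 1 = i + 1 + 1) (rfl : i + 1 = i + 1)) x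
    have h2 := LinearMap.congr_fun (koszulK_spliceMap Φ ν i) y
    have h3 := LinearMap.congr_fun (spliceMap_koszulH Φ ν i
      (by ring : i + 1 - 1 + g + 1 = i + 1 + 1 - 1 + g)) y
    simp only [LinearMap.comp_apply, LinearMap.zero_apply] at h1 h2 h3
    simp [spliceD, h1, h2, h3]
  · have h1 := LinearMap.congr_fun (koszulH_comp Φ ν
      (by ring : i + 1 - 1 + g + 1 = i + 1 + 1 - 1 + g)
      (by ring : i - 1 + g + 1 = i + 1 - 1 + g)) y
    simp only [LinearMap.comp_apply, LinearMap.zero_apply] at h1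
    simp [spliceD, h1]

/-- The complex obtained from `K_•(γ; H^g_t(S))_ν` and `K_•(γ; S)_ν` by splicing via `τ_ν`. In
homological degree `i` it is `K_i(γ; S)_ν` for `i ≤ ν` and `K_{i-1+g}(γ; H^g_t(S))_ν` for `i > ν`. It is
written here as the sum of the two for all `i`, since `K_i(γ; S)_ν = 0` for `i > ν` and
`K_{i-1+g}(γ; H^g_t(S))_ν = 0` for `i ≤ ν`. -/
def complexSplice (Φ : Matrix (Fin g) (Fin f) R) (ν : ℤ) : ChainComplex (ModuleCat.{u} R) ℤ :=
  ChainComplex.of (fun i => ModuleCat.of R (KS R f g i ν × KH R f g (i - 1 + g) ν))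
    (fun i => ModuleCat.ofHom (spliceD Φ ν i)) fun i => by
      rw [← ModuleCat.ofHom_comp, spliceD_comp]
      rfl

/-- The Buchsbaum–Eisenbud complex (generalized Koszul complex) `𝔅_•(Φ, ν)`. -/
def B (Φ : Matrix (Fin g) (Fin f) R) (ν : ℤ) : ChainComplex (ModuleCat.{u} R) ℤ :=
  if ν < 0 then complexH Φ ν
  else if ν ≤ (f : ℤ) - g then complexSplice Φ ν
  else complexS Φ ν

/-- `𝔅_•(Φ, L, ν) = 𝔅_•(Φ, ν) ⊗_R L`. -/
def BL (Φ : Matrix (Fin g) (Fin f) R) (L : Type u) [AddCommGroup L] [Module R L] (ν : ℤ) :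
    ChainComplex (ModuleCat.{u} R) ℤ :=
  ((MonoidalCategory.tensorRight (ModuleCat.of R L)).mapHomologicalComplex _).obj (B Φ ν)

/-- The cokernel `M` of `Φ : R^f → R^g`. -/
abbrev coker (Φ : Matrix (Fin g) (Fin f) R) : Type u :=
  (Fin g → R) ⧸ LinearMap.range Φ.mulVecLin

end KoszulCech

end

/-! Outside the support of `M ⊗ L`, one of `M` and `L` vanishes locally, because over a residue
field a tensor product of nonzero spaces is nonzero. As both modules are finite, some `s` outside
the given prime annihilates `M` or `L`. If `s` kills `L`, it kills every term of the complex. If `s`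
kills `M`, there are vectors `w i` with `Φ (w i) = s e_i`, and it remains to show that `s ^ g` is
homotopic to zero on `B Φ ν`; such a homotopy survives tensoring with `L`.

For a single index `i`, the homotopy `homot (w i) i` wedges with `w i` and divides by `T_i`, but
sends monomials without `T_i` to zero. Cartan's formula gives `∂h + h∂ = s` except on monomials
whose exponent at `i` is `0` or `-1`; the defect `resid` acts on each monomial through its exterior
coefficient only (`resid_mono`). Since the defects commute with `∂`, the homotopies telescope into
one between `s ^ g` and the product of all the defects (`koszulD_homotProd`).

That product kills every monomial with an exponent other than `0` and `-1`. On `S` only `T^0`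
survives, with the operator "wedge with all `w i`, then contract with all rows". On `H^g_t(S)` only
`1 / (T_1 ⋯ T_g)` survives, with the two operations in the other order. Contracting with all rows is
`τ_ν`, and wedging with all `w i` is a map `cotransgression` backwards, so the defects are the two
composites of these maps. Adding `cotransgression` to the homotopy at the splice therefore cancels
them. If `ν < 0` or `ν > f - g`, the defect passes through `⋀^ν` or `⋀^{ν+g}`, which is zero. -/

noncomputable section

namespace KoszulCech

variable {R : Type u} [CommRing R] {f g : ℕ}

/-! ### Monomials in the Koszul modules -/

/-- The element `x ⊗ T^a`. -/
def mono (x : ExteriorAlgebra R (Fin f → R)) (a : Fin g → ℤ) : Amb R f g :=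
  mkAmb R f g x (AddMonoidAlgebra.single a 1)

lemma mono_add (x y : ExteriorAlgebra R (Fin f → R)) (a : Fin g → ℤ) :
    mono (x + y) a = mono x a + mono y a := by
  simp [mono]

lemma mono_sub (x y : ExteriorAlgebra R (Fin f → R)) (a : Fin g → ℤ) :
    mono (x - y) a = mono x a - mono y a := by
  simp [mono]

lemma mono_smul (r : R) (x : ExteriorAlgebra R (Fin f → R)) (a : Fin g → ℤ) :
    mono (r • x) a = r • mono x a := by
  simp [mono]

lemma mono_zero (a : Fin g → ℤ) : mono (0 : ExteriorAlgebra R (Fin f → R)) a = 0 := by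
  simp [mono]

lemma single_eq_smul (a : Fin g → ℤ) (r : R) :
    (AddMonoidAlgebra.single a r : Laurent R g) = r • AddMonoidAlgebra.single a 1 := by
  rw [AddMonoidAlgebra.smul_single, smul_eq_mul, mul_one]

lemma mem_span_of_mem_cech {σ : Finset (Fin g)} {d : ℤ} {h : Laurent R g}
    (hh : h ∈ cech R σ d) {N : Submodule R (Laurent R g)}
    (H : ∀ a : Fin g → ℤ, (∀ i ∉ σ, 0 ≤ a i) → ∑ i, a i = d → AddMonoidAlgebra.single a 1 ∈ N) :
    h ∈ N := by
  have hs : h = ∑ a ∈ h.coeff.support, AddMonoidAlgebra.single a (h.coeff a) := by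
    refine laurent_ext fun b => ?_
    rw [AddMonoidAlgebra.coeff_sum, Finsupp.finsetSum_apply]
    simp [Finsupp.single_apply]
  rw [hs]
  refine Submodule.sum_mem _ fun a ha => ?_
  rw [Finsupp.mem_support_iff] at ha
  obtain ⟨h1, h2⟩ := mem_cech.1 hh a ha
  rw [single_eq_smul]
  exact N.smul_mem _ (H a h1 h2)

/-- The module `K_p(γ; S_{T_σ})_ν` is spanned by monomials. -/
lemma mem_of_mono_mem {σ : Finset (Fin g)} {p ν : ℤ} {N : Submodule R (Amb R f g)}
    (H : ∀ x ∈ extPow R f p, ∀ a : Fin g → ℤ, (∀ i ∉ σ, 0 ≤ a i) → ∑ i, a i = ν - p →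
      mono x a ∈ N) {z : Amb R f g} (hz : z ∈ K R f σ p ν) : z ∈ N := by
  suffices h : K R f σ p ν ≤ N from h hz
  refine Submodule.map₂_le.2 fun x hx h hh => ?_
  exact mem_span_of_mem_cech (N := N.comap (mkAmb R f g x)) hh fun a h1 h2 => H x hx a h1 h2

lemma eq_of_mono_eq {σ : Finset (Fin g)} {p ν : ℤ} {φ ψ : Module.End R (Amb R f g)}
    (H : ∀ x ∈ extPow R f p, ∀ a : Fin g → ℤ, (∀ i ∉ σ, 0 ≤ a i) → ∑ i, a i = ν - p →
      φ (mono x a) = ψ (mono x a)) {z : Amb R f g} (hz : z ∈ K R f σ p ν) : φ z = ψ z :=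
  mem_of_mono_mem (N := LinearMap.eqLocus φ ψ) H hz

lemma mono_mem {σ : Finset (Fin g)} {p ν : ℤ} {x : ExteriorAlgebra R (Fin f → R)}
    (hx : x ∈ extPow R f p) {a : Fin g → ℤ} (h1 : ∀ i ∉ σ, 0 ≤ a i) (h2 : ∑ i, a i = ν - p) :
    mono x a ∈ K R f σ p ν :=
  Submodule.apply_mem_map₂ _ hx (single_mem_cech ⟨h1, h2⟩ _)

lemma koszulD_mono (Φ : Matrix (Fin g) (Fin f) R) (x : ExteriorAlgebra R (Fin f → R))
    (a : Fin g → ℤ) :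
    koszulD Φ (mono x a) = ∑ k, mono (contr (row Φ k) x) (a + Pi.single k 1) := by
  simp only [mono, koszulD_mk, T, AddMonoidAlgebra.single_mul_single, one_mul,
    add_comm (Pi.single _ _) a]

lemma coefAmb_mono (a b : Fin g → ℤ) (x : ExteriorAlgebra R (Fin f → R)) :
    coefAmb R f b (mono x a) = if a = b then x else 0 := by
  rw [mono, coefAmb_mk, AddMonoidAlgebra.coeff_single, Finsupp.single_apply]
  split_ifs <;> simp

/-! ### Exterior multiplication -/

/-- Exterior multiplication by a vector. -/
def wedge (v : Fin f → R) : Module.End R (ExteriorAlgebra R (Fin f → R)) :=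
  LinearMap.mulLeft R (ExteriorAlgebra.ι R v)

lemma contr_wedge (d : Module.Dual R (Fin f → R)) (v : Fin f → R)
    (x : ExteriorAlgebra R (Fin f → R)) :
    contr d (wedge v x) = d v • x - wedge v (contr d x) :=
  contr_ι_mul d v x

lemma wedge_wedge (v w : Fin f → R) (x : ExteriorAlgebra R (Fin f → R)) :
    wedge v (wedge w x) = -wedge w (wedge v x) := by
  have h := ExteriorAlgebra.ι_add_mul_swap (R := R) v w
  rw [add_eq_zero_iff_eq_neg] at h
  simp only [wedge, LinearMap.mulLeft_apply, ← mul_assoc]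
  rw [h, neg_mul]

lemma wedge_mem_extPow (v : Fin f → R) {p : ℤ} {x : ExteriorAlgebra R (Fin f → R)}
    (hx : x ∈ extPow R f p) : wedge v x ∈ extPow R f (p + 1) := by
  rcases lt_or_ge p 0 with hp | hp
  · rw [extPow_of_neg hp, Submodule.mem_bot] at hx
    simp [hx]
  obtain ⟨n, rfl⟩ := Int.eq_ofNat_of_zero_le hp
  rw [extPow_natCast] at hx
  rw [show ((n : ℤ) + 1) = ((n + 1 : ℕ) : ℤ) by push_cast; ring, extPow_natCast,
    ExteriorAlgebra.exteriorPower, pow_succ']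
  exact Submodule.mul_mem_mul ⟨v, rfl⟩ hx

/-- The exterior power has a basis indexed by the `p`-element subsets of `Fin f`. This vanishing
disposes of the case `ν > f - g`. -/
lemma extPow_eq_bot {p : ℤ} (hp : (f : ℤ) < p) : extPow R f p = ⊥ := by
  obtain ⟨n, rfl⟩ := Int.eq_ofNat_of_zero_le (by omega : 0 ≤ p)
  rw [extPow_natCast, ← Submodule.subsingleton_iff_eq_bot]
  have : IsEmpty (Set.powersetCard (Fin f) n) := by
    refine ⟨fun s => ?_⟩
    have h1 : s.1.card = n := s.2
    have h2 := Finset.card_le_univ s.1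
    rw [Fintype.card_fin] at h2
    omega
  exact ((Pi.basisFun R (Fin f)).exteriorPower n).repr.toEquiv.subsingleton

/-! ### The contracting homotopies -/

/-- The `R`-linear map with `T^a ↦ T^a / T_i` if `a_i ≠ 0`, and `T^a ↦ 0` if `a_i = 0`. -/
def lower (R : Type u) [CommRing R] {g : ℕ} (i : Fin g) : Module.End R (Laurent R g) :=
  Finsupp.linearCombination R (fun a : Fin g → ℤ =>
    if a i = 0 then 0 else (AddMonoidAlgebra.single (a - Pi.single i 1) 1 : Laurent R g)) ∘ₗ
      (AddMonoidAlgebra.coeffLinearEquiv R).toLinearMap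

lemma lower_single (i : Fin g) (a : Fin g → ℤ) :
    lower R i (AddMonoidAlgebra.single a 1) =
      if a i = 0 then 0 else AddMonoidAlgebra.single (a - Pi.single i 1) 1 := by
  rw [lower, LinearMap.comp_apply]
  change Finsupp.linearCombination R _ (Finsupp.single a 1) = _
  rw [Finsupp.linearCombination_single, one_smul]

/-- The map `x ⊗ h ↦ (v ∧ x) ⊗ lower_i h`. -/
def homot (v : Fin f → R) (i : Fin g) : Module.End R (Amb R f g) :=
  mapAmb (wedge v) (lower R i)

lemma homot_mono (v : Fin f → R) (i : Fin g) (x : ExteriorAlgebra R (Fin f → R))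
    (a : Fin g → ℤ) :
    homot v i (mono x a) = if a i = 0 then 0 else mono (wedge v x) (a - Pi.single i 1) := by
  rw [mono, homot, mapAmb_mk, lower_single]
  split_ifs
  · rw [map_zero]
  · rfl

/-- Division by `T_i` happens only when the exponent is nonzero, so a nonnegative exponent at `i`
stays nonnegative. Hence the homotopy respects `S`, every `S_{T_σ}` and the image of the Čech
differential. -/
lemma homot_mem (v : Fin f → R) (i : Fin g) {σ : Finset (Fin g)} {p q ν : ℤ} (hpq : p + 1 = q)
    {z : Amb R f g} (hz : z ∈ K R f σ p ν) : homot v i z ∈ K R f σ q ν := by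
  refine mem_of_mono_mem (N := (K R f σ q ν).comap (homot v i)) (fun x hx a h1 h2 => ?_) hz
  rw [Submodule.mem_comap, homot_mono]
  split_ifs with h0
  · exact zero_mem _
  · refine mono_mem (hpq ▸ wedge_mem_extPow v hx) (fun k hk => ?_) ?_
    · have := h1 k hk
      rcases eq_or_ne k i with rfl | hne
      · simp only [Pi.sub_apply, Pi.single_eq_same]
        omega
      · simpa [Pi.sub_apply, Pi.single_eq_of_ne hne] using this
    · simp only [Pi.sub_apply, Finset.sum_sub_distrib, h2, Finset.sum_pi_single', Finset.mem_univ,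
        if_true]
      omega

/-- The operator `s - (∂ h_i + h_i ∂)`, with `h_i = homot (w i) i`. -/
def resid (Φ : Matrix (Fin g) (Fin f) R) (w : Fin g → Fin f → R) (s : R) (i : Fin g) :
    Module.End R (Amb R f g) :=
  s • 1 - (koszulD Φ * homot (w i) i + homot (w i) i * koszulD Φ)

/-- The operator induced by `resid` on the coefficients of `T^a`. -/
def residCoef (Φ : Matrix (Fin g) (Fin f) R) (w : Fin g → Fin f → R) (a : Fin g → ℤ) (i : Fin g) :
    Module.End R (ExteriorAlgebra R (Fin f → R)) :=
  if a i = 0 then contr (row Φ i) * wedge (w i)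
  else if a i = -1 then wedge (w i) * contr (row Φ i) else 0

/-- In `∂h + h∂` the terms with `k ≠ i` cancel, since `row Φ k` kills `w i` and so its contraction
anticommutes with the wedge. The two terms with `k = i` add up to `s` by Cartan's formula, unless
the zero rule of `lower` suppresses one of them. -/
lemma resid_mono {Φ : Matrix (Fin g) (Fin f) R} {w : Fin g → Fin f → R} {s : R}
    (hw : ∀ k i, row Φ k (w i) = if k = i then s else 0) (i : Fin g)
    (x : ExteriorAlgebra R (Fin f → R)) (a : Fin g → ℤ) :
    resid Φ w s i (mono x a) = mono (residCoef Φ w a i x) a := by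
  have hcomm (k : Fin g) : a + Pi.single k 1 - Pi.single i 1 = a - Pi.single i 1 + Pi.single k 1 :=
    add_sub_right_comm _ _ _
  have hval (k : Fin g) (hk : k ≠ i) : (a + Pi.single k 1 : Fin g → ℤ) i = a i := by
    simp [hk.symm]
  have hanti (k : Fin g) (hk : k ≠ i) :
      contr (row Φ k) (wedge (w i) x) = -wedge (w i) (contr (row Φ k) x) := by
    rw [contr_wedge, hw, if_neg hk, zero_smul, zero_sub]
  have hdiag : contr (row Φ i) (wedge (w i) x) = s • x - wedge (w i) (contr (row Φ i) x) := by
    rw [contr_wedge, hw, if_pos rfl]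
  have hneg (y : ExteriorAlgebra R (Fin f → R)) (b : Fin g → ℤ) : mono (-y) b = -mono y b := by
    rw [← zero_sub, mono_sub, mono_zero, zero_sub]
  simp only [resid, LinearMap.sub_apply, LinearMap.add_apply, Module.End.mul_apply,
    LinearMap.smul_apply, Module.End.one_apply, koszulD_mono, map_sum, homot_mono, residCoef]
  by_cases h0 : a i = 0
  -- Here `h` kills the monomial itself, so only the term `k = i` of `h∂` remains.
  · rw [if_pos h0, if_pos h0, map_zero, zero_add, Finset.sum_eq_single i]
    · rw [if_neg (by simp [h0]), add_sub_cancel_right, Module.End.mul_apply, hdiag, mono_sub,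
        mono_smul]
    · intro k _ hk
      rw [if_pos (by rw [hval k hk, h0])]
    · intro h; exact absurd (Finset.mem_univ _) h
  · rw [if_neg h0, if_neg h0, koszulD_mono, ← Finset.sum_add_distrib, Finset.sum_eq_single i]
    · by_cases h1 : a i = -1
      -- With exponent `-1`, multiplying by `T_i` reaches exponent `0`, where `h` vanishes, so the
      -- term `k = i` of `h∂` is lost.
      · rw [if_pos h1, if_pos (by simp [h1]), add_zero, sub_add_cancel, Module.End.mul_apply, hdiag,
          mono_sub, mono_smul, sub_sub_cancel]
      · rw [if_neg h1, if_neg (by simp; omega), LinearMap.zero_apply, mono_zero, hcomm,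
          sub_add_cancel, ← mono_add, hdiag, sub_add_cancel, mono_smul, sub_self]
    · intro k _ hk
      rw [if_neg (by rw [hval k hk]; exact h0), hcomm, hanti k hk, hneg, neg_add_cancel]
    · intro h; exact absurd (Finset.mem_univ _) h

lemma koszulD_mul_self (Φ : Matrix (Fin g) (Fin f) R) : koszulD Φ * koszulD Φ = 0 :=
  LinearMap.ext (koszulD_koszulD Φ)

/-- Since `∂² = 0`, both products of `∂` with `∂h + h∂` equal `∂h∂`. -/
lemma commute_koszulD_resid (Φ : Matrix (Fin g) (Fin f) R) (w : Fin g → Fin f → R) (s : R)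
    (i : Fin g) : Commute (koszulD Φ) (resid Φ w s i) := by
  have h := koszulD_mul_self Φ
  rw [commute_iff_eq, resid, mul_sub, sub_mul, mul_add, add_mul, ← mul_assoc, h, zero_mul,
    zero_add, mul_assoc _ (koszulD Φ), h, mul_zero, add_zero, mul_smul_comm, smul_mul_assoc,
    mul_one, one_mul, mul_assoc]

/-! ### Telescoping the homotopies over a list of indices -/

/-- The composite of the operators `resid` along a list of indices. -/
def residProd (Φ : Matrix (Fin g) (Fin f) R) (w : Fin g → Fin f → R) (s : R) (l : List (Fin g)) :
    Module.End R (Amb R f g) :=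
  (l.map (resid Φ w s)).prod

/-- The homotopy from `s ^ l.length` to `residProd l`. -/
def homotProd (Φ : Matrix (Fin g) (Fin f) R) (w : Fin g → Fin f → R) (s : R) :
    List (Fin g) → Module.End R (Amb R f g)
  | [] => 0
  | i :: l => homot (w i) i * residProd Φ w s l + s • homotProd Φ w s l

lemma commute_koszulD_residProd (Φ : Matrix (Fin g) (Fin f) R) (w : Fin g → Fin f → R) (s : R)
    (l : List (Fin g)) : Commute (koszulD Φ) (residProd Φ w s l) := by
  refine Commute.list_prod_right _ _ fun y hy => ?_
  obtain ⟨i, -, rfl⟩ := List.mem_map.1 hy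
  exact commute_koszulD_resid Φ w s i

/-- Writing `ρ` for the defect at `i` and `P` for the product over the tail, the induction is the
identity `s ^ (n+1) - ρP = (s - ρ)P + s(s ^ n - P)`, where `n` is the length of the tail. Moving `∂`
past `P` is allowed because they commute. -/
lemma koszulD_homotProd (Φ : Matrix (Fin g) (Fin f) R) (w : Fin g → Fin f → R) (s : R)
    (l : List (Fin g)) :
    koszulD Φ * homotProd Φ w s l + homotProd Φ w s l * koszulD Φ =
      s ^ l.length • 1 - residProd Φ w s l := by
  induction l with
  | nil => simp [homotProd, residProd]
  | cons i l ih =>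
    have h1 : koszulD Φ * homot (w i) i + homot (w i) i * koszulD Φ = s • 1 - resid Φ w s i := by
      rw [resid, sub_sub_cancel]
    have h2 : residProd Φ w s (i :: l) = resid Φ w s i * residProd Φ w s l := List.prod_cons
    calc koszulD Φ * homotProd Φ w s (i :: l) + homotProd Φ w s (i :: l) * koszulD Φ
        = (koszulD Φ * homot (w i) i + homot (w i) i * koszulD Φ) * residProd Φ w s l +
          s • (koszulD Φ * homotProd Φ w s l + homotProd Φ w s l * koszulD Φ) := by
          rw [homotProd, mul_add, add_mul, mul_assoc _ (residProd Φ w s l),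
            ← (commute_koszulD_residProd Φ w s l).eq, mul_smul_comm, smul_mul_assoc, add_mul,
            smul_add, mul_assoc, mul_assoc]
          abel
      _ = _ := by
          rw [h1, ih, h2, sub_mul, smul_sub, smul_smul, smul_mul_assoc, one_mul, List.length_cons,
            pow_succ']
          abel

lemma residProd_mem {Φ : Matrix (Fin g) (Fin f) R} {w : Fin g → Fin f → R} {s : R}
    (l : List (Fin g)) {σ : Finset (Fin g)} {p ν : ℤ} {z : Amb R f g} (hz : z ∈ K R f σ p ν) :
    residProd Φ w s l z ∈ K R f σ p ν := by
  induction l with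
  | nil => exact hz
  | cons i l ih =>
    rw [residProd, List.map_cons, List.prod_cons, Module.End.mul_apply]
    change resid Φ w s i (residProd Φ w s l z) ∈ _
    refine Submodule.sub_mem _ (Submodule.smul_mem _ _ ih) (Submodule.add_mem _ ?_ ?_)
    · exact koszulD_mem Φ rfl (homot_mem (w i) i rfl ih)
    · exact homot_mem (w i) i (sub_add_cancel _ _) (koszulD_mem Φ (sub_add_cancel _ _) ih)

lemma homotProd_mem {Φ : Matrix (Fin g) (Fin f) R} {w : Fin g → Fin f → R} {s : R}
    (l : List (Fin g)) {σ : Finset (Fin g)} {p q ν : ℤ} (hpq : p + 1 = q) {z : Amb R f g}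
    (hz : z ∈ K R f σ p ν) : homotProd Φ w s l z ∈ K R f σ q ν := by
  induction l with
  | nil => exact zero_mem _
  | cons i l ih =>
    exact Submodule.add_mem _ (homot_mem (w i) i hpq (residProd_mem l hz))
      (Submodule.smul_mem _ _ ih)

lemma residProd_mono {Φ : Matrix (Fin g) (Fin f) R} {w : Fin g → Fin f → R} {s : R}
    (hw : ∀ k i, row Φ k (w i) = if k = i then s else 0) (l : List (Fin g))
    (x : ExteriorAlgebra R (Fin f → R)) (a : Fin g → ℤ) :
    residProd Φ w s l (mono x a) = mono ((l.map (residCoef Φ w a)).prod x) a := by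
  induction l with
  | nil => rfl
  | cons i l ih =>
    rw [residProd, List.map_cons, List.prod_cons, Module.End.mul_apply]
    change resid Φ w s i (residProd Φ w s l (mono x a)) = _
    rw [ih, resid_mono hw, List.map_cons, List.prod_cons, Module.End.mul_apply]

lemma prod_residCoef_eq_zero (Φ : Matrix (Fin g) (Fin f) R) (w : Fin g → Fin f → R)
    {a : Fin g → ℤ} {i : Fin g} (h0 : a i ≠ 0) (h1 : a i ≠ -1) {l : List (Fin g)} (hi : i ∈ l) :
    (l.map (residCoef Φ w a)).prod = 0 := by
  refine List.prod_eq_zero (List.mem_map.2 ⟨i, hi, ?_⟩)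
  rw [residCoef, if_neg h0, if_neg h1]

/-! ### Products of contractions and of exterior multiplications -/

/-- The composite of the contractions by the rows of `Φ` with index in a list. -/
def contrProd (Φ : Matrix (Fin g) (Fin f) R) (l : List (Fin g)) :
    Module.End R (ExteriorAlgebra R (Fin f → R)) :=
  (l.map fun i => contr (row Φ i)).prod

/-- The composite, in the opposite order, of the exterior multiplications by the vectors `w_i`
with index in a list. -/
def wedgeProd (w : Fin g → Fin f → R) :
    List (Fin g) → Module.End R (ExteriorAlgebra R (Fin f → R))
  | [] => 1
  | i :: l => wedgeProd w l * wedge (w i)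

/-- The reversed order in `wedgeProd` places the two factors for the head `i` outermost, around the
product for the tail. Wedging with `w i` commutes with each tail factor, being moved past one wedge
and one contraction, each at the cost of a sign. -/
lemma contrProd_mul_wedgeProd {Φ : Matrix (Fin g) (Fin f) R} {w : Fin g → Fin f → R} {s : R}
    (hw : ∀ k i, row Φ k (w i) = if k = i then s else 0) {l : List (Fin g)} (hl : l.Nodup) :
    contrProd Φ l * wedgeProd w l = (l.map (residCoef Φ w 0)).prod := by
  induction l with
  | nil => rfl
  | cons i l ih =>
    obtain ⟨hi, hl⟩ := List.nodup_cons.1 hl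
    have hc : Commute (wedge (w i)) (l.map (residCoef Φ w 0)).prod := by
      refine Commute.list_prod_right _ _ fun y hy => ?_
      obtain ⟨k, hk, rfl⟩ := List.mem_map.1 hy
      have hik : k ≠ i := fun h => hi (h ▸ hk)
      refine LinearMap.ext fun x => ?_
      simp only [residCoef, Pi.zero_apply, if_true, Module.End.mul_apply]
      rw [wedge_wedge (w k), map_neg, contr_wedge (row Φ k) (w i), hw, if_neg hik, zero_smul,
        zero_sub, neg_neg]
    rw [contrProd, List.map_cons, List.prod_cons, wedgeProd, List.map_cons, List.prod_cons,
      mul_assoc, ← mul_assoc _ (wedgeProd w l)]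
    change _ * (contrProd Φ l * wedgeProd w l * _) = _
    rw [ih hl, ← hc.eq, ← mul_assoc]
    rfl

/-- Here the two factors for the head `i` meet in the middle. Their composite commutes with the
wedges of the tail, again through two sign changes, and can be pulled out to the left. -/
lemma wedgeProd_mul_contrProd {Φ : Matrix (Fin g) (Fin f) R} {w : Fin g → Fin f → R} {s : R}
    (hw : ∀ k i, row Φ k (w i) = if k = i then s else 0) {l : List (Fin g)} (hl : l.Nodup) :
    wedgeProd w l * contrProd Φ l = (l.map (residCoef Φ w (fun _ => -1))).prod := by
  induction l with
  | nil => rfl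
  | cons i l ih =>
    obtain ⟨hi, hl⟩ := List.nodup_cons.1 hl
    have hc (m : List (Fin g)) (him : i ∉ m) :
        Commute (wedge (w i) * contr (row Φ i)) (wedgeProd w m) := by
      induction m with
      | nil => exact Commute.one_right _
      | cons k m ihm =>
        rw [List.mem_cons, not_or] at him
        refine Commute.mul_right (ihm him.2) (LinearMap.ext fun x => ?_)
        simp only [Module.End.mul_apply]
        rw [contr_wedge, hw, if_neg him.1, zero_smul, zero_sub, map_neg, wedge_wedge, neg_neg]
    rw [contrProd, List.map_cons, List.prod_cons, wedgeProd, List.map_cons, List.prod_cons]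
    change _ * (_ * contrProd Φ l) = _
    rw [← ih hl, ← mul_assoc, mul_assoc _ (wedge (w i)), ← (hc l hi).eq, mul_assoc]
    rfl

lemma wedgeProd_mem_extPow (w : Fin g → Fin f → R) (l : List (Fin g)) {p : ℤ}
    {x : ExteriorAlgebra R (Fin f → R)} (hx : x ∈ extPow R f p) :
    wedgeProd w l x ∈ extPow R f (p + l.length) := by
  induction l generalizing p x with
  | nil => simpa [wedgeProd] using hx
  | cons i l ih =>
    have := ih (wedge_mem_extPow (w i) hx)
    rwa [show p + 1 + (l.length : ℤ) = p + (i :: l).length by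
      rw [List.length_cons]; push_cast; ring] at this

/-- Identifies the contraction that defines `τ_ν` with the one that occurs in the product of
defects. -/
lemma Q_univ_eq_contrProd (Φ : Matrix (Fin g) (Fin f) R) :
    Q Φ Finset.univ g = contrProd Φ (List.finRange g) := by
  suffices h : ∀ k ≤ g, Q Φ Finset.univ k = contrProd Φ ((List.finRange g).take k) by
    have := h g le_rfl
    rwa [List.take_of_length_le (by simp)] at this
  intro k hk
  induction k with
  | zero => simp [Q, contrProd]
  | succ k ih =>
    have h1 : (List.finRange g).take (k + 1) = (List.finRange g).take k ++ [⟨k, hk⟩] := by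
      rw [List.take_succ_eq_append_getElem (by simpa using hk)]
      simp
    rw [h1, contrProd, List.map_append, List.prod_append, List.map_singleton, List.prod_singleton]
    exact (Q_succ_of_mem Φ (Finset.mem_univ ⟨k, hk⟩)).trans (by rw [ih (by omega)])

/-! ### The operator `residProd` on polynomials and on local cohomology -/

lemma negInd_univ : negInd (Finset.univ : Finset (Fin g)) = fun _ => -1 := by
  ext i
  simp [negInd]

/-- Exponents are nonnegative here, so a monomial other than `T^0` has an exponent at least `1` and
is killed by the corresponding factor. -/
lemma residProd_of_mem_empty {Φ : Matrix (Fin g) (Fin f) R} {w : Fin g → Fin f → R} {s : R}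
    (hw : ∀ k i, row Φ k (w i) = if k = i then s else 0) {p ν : ℤ} {z : Amb R f g}
    (hz : z ∈ K R f ∅ p ν) :
    residProd Φ w s (List.finRange g) z =
      mono (contrProd Φ (List.finRange g) (wedgeProd w (List.finRange g) (coefAmb R f 0 z))) 0 := by
  refine eq_of_mono_eq (ψ := (mkAmb R f g).flip (AddMonoidAlgebra.single 0 1) ∘ₗ
    (contrProd Φ (List.finRange g) * wedgeProd w (List.finRange g)) ∘ₗ coefAmb R f 0)
    (fun x hx a h1 h2 => ?_) hz
  simp only [LinearMap.comp_apply, LinearMap.flip_apply]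
  rw [residProd_mono hw, coefAmb_mono, contrProd_mul_wedgeProd hw (List.nodup_finRange g)]
  change _ = mono _ _
  split_ifs with ha
  · rw [ha]
  · obtain ⟨i, hi⟩ := Function.ne_iff.1 ha
    have := h1 i (Finset.notMem_empty i)
    rw [prod_residCoef_eq_zero Φ w hi (by omega) (List.mem_finRange i), LinearMap.zero_apply,
      map_zero, mono_zero, mono_zero]

lemma residProd_sub_mem_cechBoundary {Φ : Matrix (Fin g) (Fin f) R} {w : Fin g → Fin f → R} {s : R}
    (hw : ∀ k i, row Φ k (w i) = if k = i then s else 0) {p ν : ℤ} {z : Amb R f g}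
    (hz : z ∈ K R f Finset.univ p ν) :
    residProd Φ w s (List.finRange g) z -
      mono (wedgeProd w (List.finRange g) (contrProd Φ (List.finRange g)
        (coefAmb R f (negInd Finset.univ) z))) (negInd Finset.univ) ∈
      cechBoundary R f g p ν := by
  refine mem_of_mono_mem (N := (cechBoundary R f g p ν).comap
    (residProd Φ w s (List.finRange g) -
      (mkAmb R f g).flip (AddMonoidAlgebra.single (negInd Finset.univ) 1) ∘ₗ
        (wedgeProd w (List.finRange g) * contrProd Φ (List.finRange g)) ∘ₗ
          coefAmb R f (negInd Finset.univ))) (fun x hx a h1 h2 => ?_) hz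
  simp only [Submodule.mem_comap, LinearMap.sub_apply, LinearMap.comp_apply, LinearMap.flip_apply]
  change _ - mono _ _ ∈ _
  rw [coefAmb_mono, wedgeProd_mul_contrProd hw (List.nodup_finRange g)]
  split_ifs with ha
  · rw [residProd_mono hw, ha, negInd_univ, sub_self]
    exact zero_mem _
  · rw [map_zero, mono_zero, sub_zero]
    -- A monomial with a nonnegative exponent is a Čech boundary, and `residProd` preserves
    -- boundaries. If all exponents are negative but not all are `-1`, one is at most `-2` and its
    -- factor is zero.
    by_cases hneg : ∃ i, 0 ≤ a i
    · obtain ⟨i, hi⟩ := hneg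
      refine Submodule.mem_iSup_of_mem i (residProd_mem _ (mono_mem hx (fun k hk => ?_) h2))
      simp only [Finset.mem_erase, Finset.mem_univ, and_true, not_not] at hk
      exact hk ▸ hi
    · push Not at hneg
      rw [negInd_univ] at ha
      obtain ⟨i, hi⟩ := Function.ne_iff.1 ha
      rw [residProd_mono hw, prod_residCoef_eq_zero Φ w (hneg i).ne hi (List.mem_finRange i),
        LinearMap.zero_apply, mono_zero]
      exact zero_mem _

/-! ### The homotopies on the strands -/

/-- The homotopy `K_p(γ; S_{T_σ})_ν → K_{p+1}(γ; S_{T_σ})_ν`. -/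
def homotK (Φ : Matrix (Fin g) (Fin f) R) (w : Fin g → Fin f → R) (s : R) (σ : Finset (Fin g))
    (ν : ℤ) {p q : ℤ} (hpq : p + 1 = q) : K R f σ p ν →ₗ[R] K R f σ q ν :=
  (homotProd Φ w s (List.finRange g)).restrict fun _ hz => homotProd_mem _ hpq hz

/-- The homotopy `K_p(γ; H^g_t(S))_ν → K_{p+1}(γ; H^g_t(S))_ν`. -/
def homotH (Φ : Matrix (Fin g) (Fin f) R) (w : Fin g → Fin f → R) (s : R) (ν : ℤ) {p q : ℤ}
    (hpq : p + 1 = q) : KH R f g p ν →ₗ[R] KH R f g q ν :=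
  Submodule.mapQ _ _ (homotK Φ w s Finset.univ ν hpq) fun z hz => by
    suffices h : cechBoundary R f g p ν ≤
      (cechBoundary R f g q ν).comap (homotProd Φ w s (List.finRange g)) from h hz
    exact iSup_le fun i z hz => Submodule.mem_iSup_of_mem i (homotProd_mem _ hpq hz)

lemma koszulD_homotProd_apply (Φ : Matrix (Fin g) (Fin f) R) (w : Fin g → Fin f → R) (s : R)
    (z : Amb R f g) :
    koszulD Φ (homotProd Φ w s (List.finRange g) z) +
      homotProd Φ w s (List.finRange g) (koszulD Φ z) =
        s ^ g • z - residProd Φ w s (List.finRange g) z := by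
  have h := LinearMap.congr_fun (koszulD_homotProd Φ w s (List.finRange g)) z
  rwa [List.length_finRange] at h

lemma koszulK_homotK {Φ : Matrix (Fin g) (Fin f) R} {w : Fin g → Fin f → R} {s : R}
    (hw : ∀ k i, row Φ k (w i) = if k = i then s else 0) {p q r ν : ℤ} (hpq : p + 1 = q)
    (hrp : r + 1 = p) (x : KS R f g p ν) :
    ((koszulK Φ ∅ ν hpq (homotK Φ w s ∅ ν hpq x) +
      homotK Φ w s ∅ ν hrp (koszulK Φ ∅ ν hrp x) : KS R f g p ν) : Amb R f g) =
      s ^ g • (x : Amb R f g) - mono (contrProd Φ (List.finRange g)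
        (wedgeProd w (List.finRange g) (coefAmb R f 0 (x : Amb R f g)))) 0 := by
  rw [← residProd_of_mem_empty hw x.2]
  exact koszulD_homotProd_apply Φ w s x

/-- For `p ≠ ν` degree reasons exclude a `T^0` coefficient; for `p = ν` the wedge product lies in
`⋀^{p+g} R^f`, which is zero as `p + g > f`. -/
lemma koszulK_homotK_of_ne {Φ : Matrix (Fin g) (Fin f) R} {w : Fin g → Fin f → R} {s : R}
    (hw : ∀ k i, row Φ k (w i) = if k = i then s else 0) {p q r ν : ℤ} (hpq : p + 1 = q)
    (hrp : r + 1 = p) (h : p = ν → (f : ℤ) < p + g) (x : KS R f g p ν) :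
    koszulK Φ ∅ ν hpq (homotK Φ w s ∅ ν hpq x) +
      homotK Φ w s ∅ ν hrp (koszulK Φ ∅ ν hrp x) = s ^ g • x := by
  refine Subtype.ext ((koszulK_homotK hw hpq hrp x).trans ?_)
  have h0 : wedgeProd w (List.finRange g) (coefAmb R f 0 (x : Amb R f g)) = 0 := by
    by_cases hp : p = ν
    · have := wedgeProd_mem_extPow w (List.finRange g) (coefAmb_mem x.2 0)
      rwa [List.length_finRange, extPow_eq_bot (h hp), Submodule.mem_bot] at this
    · rw [coefAmb_eq_zero x.2, map_zero]
      rintro ⟨-, h2⟩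
      simp only [Pi.zero_apply, Finset.sum_const_zero] at h2
      omega
  rw [h0, map_zero, mono_zero, sub_zero]
  rfl

/-- The correction term is passed as a class `y`, so that it can be specialized both to `0` and to
the value of `cotransgression` after `τ_ν`. -/
lemma koszulH_homotH {Φ : Matrix (Fin g) (Fin f) R} {w : Fin g → Fin f → R} {s : R}
    (hw : ∀ k i, row Φ k (w i) = if k = i then s else 0) {p q r ν : ℤ} (hpq : p + 1 = q)
    (hrp : r + 1 = p) (x : K R f (Finset.univ : Finset (Fin g)) p ν) (y : KH R f g p ν)
    (hy : ∃ hm : mono (wedgeProd w (List.finRange g) (contrProd Φ (List.finRange g)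
        (coefAmb R f (negInd Finset.univ) (x : Amb R f g)))) (negInd Finset.univ) ∈
          K R f Finset.univ p ν, Submodule.Quotient.mk ⟨_, hm⟩ = y) :
    koszulH Φ ν hpq (homotH Φ w s ν hpq (Submodule.Quotient.mk x)) +
      homotH Φ w s ν hrp (koszulH Φ ν hrp (Submodule.Quotient.mk x)) + y =
        s ^ g • Submodule.Quotient.mk x := by
  obtain ⟨hm, rfl⟩ := hy
  have h1 : koszulH Φ ν hpq (homotH Φ w s ν hpq (Submodule.Quotient.mk x)) +
      homotH Φ w s ν hrp (koszulH Φ ν hrp (Submodule.Quotient.mk x)) =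
      Submodule.Quotient.mk (koszulK Φ Finset.univ ν hpq (homotK Φ w s Finset.univ ν hpq x) +
      homotK Φ w s Finset.univ ν hrp (koszulK Φ Finset.univ ν hrp x)) := rfl
  rw [h1, ← Submodule.Quotient.mk_add, ← Submodule.Quotient.mk_smul, eq_comm, Submodule.Quotient.eq]
  have h2 := residProd_sub_mem_cechBoundary (s := s) hw x.2
  change s ^ g • (x : Amb R f g) - (koszulD Φ (homotProd Φ w s (List.finRange g) x) +
      homotProd Φ w s (List.finRange g) (koszulD Φ x) + mono _ _) ∈ cechBoundary R f g p ν
  rw [koszulD_homotProd_apply, ← sub_sub, sub_sub_cancel]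
  exact h2

/-- The coefficient of `1 / (T_1 ⋯ T_g)` can be nonzero only for `p = ν + g`; contracting it `g`
times then lands in `⋀^ν`, which is zero for negative `ν`. -/
lemma koszulH_homotH_of_neg {Φ : Matrix (Fin g) (Fin f) R} {w : Fin g → Fin f → R} {s : R}
    (hw : ∀ k i, row Φ k (w i) = if k = i then s else 0) {p q r ν : ℤ} (hpq : p + 1 = q)
    (hrp : r + 1 = p) (h : p = ν + g → ν < 0) (y : KH R f g p ν) :
    koszulH Φ ν hpq (homotH Φ w s ν hpq y) + homotH Φ w s ν hrp (koszulH Φ ν hrp y) =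
      s ^ g • y := by
  obtain ⟨x, rfl⟩ := Submodule.Quotient.mk_surjective _ y
  have h0 : contrProd Φ (List.finRange g) (coefAmb R f (negInd Finset.univ) (x : Amb R f g)) =
      0 := by
    by_cases hp : p = ν + g
    · have := Q_mem_extPow' Φ Finset.univ (coefAmb_mem x.2 (negInd Finset.univ))
      rwa [Finset.card_univ, Fintype.card_fin, extPow_of_neg (by have := h hp; omega),
        Submodule.mem_bot, Q_univ_eq_contrProd] at this
    · rw [coefAmb_eq_zero x.2, map_zero]
      rintro ⟨-, h2⟩
      rw [sum_negInd, Finset.card_univ, Fintype.card_fin] at h2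
      omega
  have := koszulH_homotH hw hpq hrp x 0 (by
    rw [h0, map_zero, mono_zero]
    exact ⟨zero_mem _, Submodule.Quotient.mk_zero _⟩)
  rwa [add_zero] at this

/-! ### The defects as composites of `transgression` and `cotransgression` -/

/-- The map `K_ν(γ; S)_ν → K_{ν+g}(γ; H^g_t(S))_ν` with
`x ⊗ 1 ↦ (w_g ∧ ⋯ ∧ w_1 ∧ x) ⊗ 1 / (T_1 ⋯ T_g)`. -/
def cotransgression (w : Fin g → Fin f → R) {p n ν : ℤ} (hp : p = ν + g) (hn : n = ν) :
    KS R f g n ν →ₗ[R] KH R f g p ν :=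
  Submodule.mkQ _ ∘ₗ LinearMap.restrict (p := K R f ∅ n ν) (q := K R f Finset.univ p ν)
    ((mkAmb R f g).flip (AddMonoidAlgebra.single (negInd Finset.univ) 1) ∘ₗ
      wedgeProd w (List.finRange g) ∘ₗ coefAmb R f 0)
    fun z hz => by
      refine mono_mem ?_ (fun i hi => absurd (Finset.mem_univ i) hi) ?_
      · have := wedgeProd_mem_extPow w (List.finRange g) (coefAmb_mem hz 0)
        rwa [List.length_finRange, hn, ← hp] at this
      · rw [sum_negInd, Finset.card_univ, Fintype.card_fin]
        omega

lemma koszulK_homotK_of_eq {Φ : Matrix (Fin g) (Fin f) R} {w : Fin g → Fin f → R} {s : R}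
    (hw : ∀ k i, row Φ k (w i) = if k = i then s else 0) {n p q r ν : ℤ} (hpq : p + 1 = q)
    (hrp : r + 1 = p) (hn : n = ν + g) (hp : p = ν) (x : KS R f g p ν) :
    koszulK Φ ∅ ν hpq (homotK Φ w s ∅ ν hpq x) + homotK Φ w s ∅ ν hrp (koszulK Φ ∅ ν hrp x) +
      transgression Φ hn hp (cotransgression w hn hp x) = s ^ g • x := by
  refine Subtype.ext ?_
  rw [Submodule.coe_add, koszulK_homotK hw hpq hrp x]
  have h : (transgression Φ hn hp (cotransgression w hn hp x) : Amb R f g) =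
      mono (contrProd Φ (List.finRange g)
        (wedgeProd w (List.finRange g) (coefAmb R f 0 (x : Amb R f g)))) 0 := by
    refine (transgression_mk Φ hn hp _).trans ?_
    rw [tauAmb_apply, Q_univ_eq_contrProd]
    change mono (contrProd Φ _ (coefAmb R f _ (mono _ _))) 0 = _
    rw [coefAmb_mono, if_pos rfl]
    rfl
  rw [h, sub_add_cancel]
  rfl

lemma koszulH_homotH_of_eq {Φ : Matrix (Fin g) (Fin f) R} {w : Fin g → Fin f → R} {s : R}
    (hw : ∀ k i, row Φ k (w i) = if k = i then s else 0) {n p q r ν : ℤ} (hpq : p + 1 = q)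
    (hrp : r + 1 = p) (hp : p = ν + g) (hn : n = ν) (y : KH R f g p ν) :
    koszulH Φ ν hpq (homotH Φ w s ν hpq y) + homotH Φ w s ν hrp (koszulH Φ ν hrp y) +
      cotransgression w hp hn (transgression Φ hp hn y) = s ^ g • y := by
  obtain ⟨x, rfl⟩ := Submodule.Quotient.mk_surjective _ y
  refine koszulH_homotH hw hpq hrp x _ ?_
  have h : coefAmb R f 0 (transgression Φ hp hn (Submodule.Quotient.mk x) : Amb R f g) =
      contrProd Φ (List.finRange g) (coefAmb R f (negInd Finset.univ) (x : Amb R f g)) := by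
    rw [transgression_mk, tauAmb_apply, Q_univ_eq_contrProd]
    change coefAmb R f 0 (mono _ 0) = _
    rw [coefAmb_mono, if_pos rfl]
  rw [← h]
  exact ⟨_, rfl⟩

/-! ### Homotopies of chain complexes -/

/-- A contracting homotopy up to the scalar `r` of a chain complex given by its differentials. -/
lemma nonempty_homotopy_of {X : ℤ → ModuleCat.{u} R} {d : ∀ n, X (n + 1) ⟶ X n}
    {sq : ∀ n, d (n + 1) ≫ d n = 0} (r : R) (h : ∀ n, X n →ₗ[R] X (n + 1))
    (H : ∀ n (x : X (n + 1)),
      (d (n + 1)).hom (h (n + 1) x) + h n ((d n).hom x) = r • x) :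
    Nonempty (Homotopy (r • 𝟙 (ChainComplex.of X d sq)) 0) := by
  let hom : ∀ i j, (ComplexShape.down ℤ).Rel j i →
      ((ChainComplex.of X d sq).X i ⟶ (ChainComplex.of X d sq).X j) := fun i j hij =>
    ModuleCat.ofHom (h i) ≫ eqToHom (by rw [show i + 1 = j from hij])
  refine ⟨(Homotopy.ofEq ?_).trans (Homotopy.nullHomotopy' hom)⟩
  ext k : 1
  -- Over `ℤ` every index is a successor, so the hypothesis `H` covers all degrees.
  obtain ⟨n, rfl⟩ : ∃ n, n + 1 = k := ⟨k - 1, by ring⟩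
  rw [Homotopy.nullHomotopicMap'_f (k₂ := n + 1 + 1) (k₀ := n) rfl rfl]
  refine ModuleCat.hom_ext (LinearMap.ext fun x => ?_)
  have h1 : (ChainComplex.of X d sq).d (n + 1) n = d n := ChainComplex.of_d ..
  have h2 : (ChainComplex.of X d sq).d (n + 1 + 1) (n + 1) = d (n + 1) := ChainComplex.of_d ..
  rw [h1, h2]
  simp only [hom, eqToHom_refl, Category.comp_id]
  exact ((add_comm _ _).trans (H n x)).symm

lemma nonempty_homotopy_complexS {Φ : Matrix (Fin g) (Fin f) R} {w : Fin g → Fin f → R} {s : R}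
    (hw : ∀ k i, row Φ k (w i) = if k = i then s else 0) {ν : ℤ} (hν : (f : ℤ) - g < ν) :
    Nonempty (Homotopy (s ^ g • 𝟙 (complexS Φ ν)) 0) := by
  unfold complexS
  exact nonempty_homotopy_of (s ^ g) (fun _ => homotK Φ w s ∅ ν rfl) fun n x =>
    koszulK_homotK_of_ne hw rfl rfl (fun _ => by omega) x

lemma nonempty_homotopy_complexH {Φ : Matrix (Fin g) (Fin f) R} {w : Fin g → Fin f → R} {s : R}
    (hw : ∀ k i, row Φ k (w i) = if k = i then s else 0) {ν : ℤ} (hν : ν < 0) :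
    Nonempty (Homotopy (s ^ g • 𝟙 (complexH Φ ν)) 0) := by
  unfold complexH
  exact nonempty_homotopy_of (s ^ g) (fun n => homotH Φ w s ν (add_assoc _ n 1)) fun n x =>
    koszulH_homotH_of_neg hw (add_assoc _ _ 1) (add_assoc _ n 1) (fun _ => hν) x

/-! ### The homotopy on the spliced complex -/

/-- The map from the first to the second summand of the homotopy on the spliced complex. -/
def cospliceMap (R : Type u) [CommRing R] {f g : ℕ} (w : Fin g → Fin f → R) (ν i : ℤ) :
    KS R f g i ν →ₗ[R] KH R f g (i + 1 - 1 + g) ν :=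
  if h : i = ν then cotransgression w (by rw [h]; ring) h else 0

/-- The homotopy on the spliced complex. -/
def spliceHomot (Φ : Matrix (Fin g) (Fin f) R) (w : Fin g → Fin f → R) (s : R) (ν i : ℤ) :
    (KS R f g i ν × KH R f g (i - 1 + g) ν) →ₗ[R]
      (KS R f g (i + 1) ν × KH R f g (i + 1 - 1 + g) ν) :=
  LinearMap.prod (homotK Φ w s ∅ ν rfl ∘ₗ LinearMap.fst R _ _)
    ((cospliceMap R w ν i).coprod
      (homotH Φ w s ν (by ring : i - 1 + g + 1 = i + 1 - 1 + g)))

lemma KS_eq_zero {p ν : ℤ} (h : ν < p) (x : KS R f g p ν) : x = 0 := by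
  exact Subtype.ext ((Submodule.mem_bot R).1 ((K_empty_eq_bot h).le x.2))

/-- A computation with 2 × 2 block matrices. The diagonal blocks are the strand identities,
corrected by the composites of `spliceMap` and `cospliceMap`; the other contributions vanish. -/
lemma spliceD_spliceHomot {Φ : Matrix (Fin g) (Fin f) R} {w : Fin g → Fin f → R} {s : R}
    (hw : ∀ k i, row Φ k (w i) = if k = i then s else 0) (ν i : ℤ)
    (x : KS R f g (i + 1) ν) (y : KH R f g (i + 1 - 1 + g) ν) :
    spliceD Φ ν (i + 1) (spliceHomot Φ w s ν (i + 1) (x, y)) +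
      spliceHomot Φ w s ν i (spliceD Φ ν i (x, y)) = s ^ g • (x, y) := by
  -- In `h1` to `h4` the splicing maps are zero except at the index `ν`. There the composite has its
  -- source or target in `K_p(γ; S)_ν` with `p > ν`, or in `K_p(γ; H^g_t(S))_ν` with `p < ν + g`,
  -- and both are zero.
  have h1 : homotK Φ w s ∅ ν (rfl : i + 1 = i + 1) (spliceMap Φ ν i y) = 0 := by
    by_cases hi : i = ν
    · exact KS_eq_zero (by omega) _
    · rw [spliceMap, dif_neg hi, LinearMap.zero_apply, map_zero]
  have h2 (y' : KH R f g (i + 1 + 1 - 1 + g) ν) (hy : i + 1 = ν → y' = 0) :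
      spliceMap Φ ν (i + 1) y' = 0 := by
    by_cases hi : i + 1 = ν
    · rw [hy hi, map_zero]
    · rw [spliceMap, dif_neg hi, LinearMap.zero_apply]
  have h3 : koszulH Φ ν (by ring : i + 1 - 1 + g + 1 = i + 1 + 1 - 1 + g)
      (cospliceMap R w ν (i + 1) x) = 0 := by
    by_cases hi : i + 1 = ν
    · exact KH_eq_zero (by omega) _
    · rw [cospliceMap, dif_neg hi, LinearMap.zero_apply, map_zero]
  have h4 : cospliceMap R w ν i (koszulK Φ ∅ ν rfl x) = 0 := by
    by_cases hi : i = ν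
    · rw [KS_eq_zero (by omega) x, map_zero, map_zero]
    · rw [cospliceMap, dif_neg hi, LinearMap.zero_apply]
  refine Prod.ext ?_ ?_
  · change koszulK Φ ∅ ν rfl (homotK Φ w s ∅ ν rfl x) +
      spliceMap Φ ν (i + 1) (cospliceMap R w ν (i + 1) x + homotH Φ w s ν _ y) +
      homotK Φ w s ∅ ν rfl (koszulK Φ ∅ ν rfl x + spliceMap Φ ν i y) = s ^ g • x
    rw [map_add, map_add, h1, h2 (homotH Φ w s ν _ y) fun hi => by
      rw [KH_eq_zero (by omega) y, map_zero], add_zero, add_zero, add_right_comm]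
    by_cases hi : i + 1 = ν
    · rw [spliceMap, cospliceMap, dif_pos hi, dif_pos hi]
      exact koszulK_homotK_of_eq hw rfl rfl _ hi x
    · rw [spliceMap, dif_neg hi, LinearMap.zero_apply, add_zero]
      exact koszulK_homotK_of_ne hw rfl rfl (fun h => absurd h hi) x
  · change koszulH Φ ν _ (cospliceMap R w ν (i + 1) x + homotH Φ w s ν _ y) +
      (cospliceMap R w ν i (koszulK Φ ∅ ν rfl x + spliceMap Φ ν i y) +
        homotH Φ w s ν _ (koszulH Φ ν _ y)) = s ^ g • y
    rw [map_add, map_add, h3, h4, zero_add, zero_add, add_comm (cospliceMap R w ν i _), ← add_assoc]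
    by_cases hi : i = ν
    · rw [spliceMap, cospliceMap, dif_pos hi, dif_pos hi]
      exact koszulH_homotH_of_eq hw _ _ _ hi y
    · rw [cospliceMap, dif_neg hi, LinearMap.zero_apply, add_zero]
      exact koszulH_homotH_of_neg hw _ _ (fun h => absurd (by omega) hi) y

lemma nonempty_homotopy_complexSplice {Φ : Matrix (Fin g) (Fin f) R} {w : Fin g → Fin f → R}
    {s : R} (hw : ∀ k i, row Φ k (w i) = if k = i then s else 0) (ν : ℤ) :
    Nonempty (Homotopy (s ^ g • 𝟙 (complexSplice Φ ν)) 0) := by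
  unfold complexSplice
  exact nonempty_homotopy_of (s ^ g) (spliceHomot Φ w s ν) fun n x =>
    spliceD_spliceHomot hw ν n x.1 x.2

lemma nonempty_homotopy_B {Φ : Matrix (Fin g) (Fin f) R} {w : Fin g → Fin f → R} {s : R}
    (hw : ∀ k i, row Φ k (w i) = if k = i then s else 0) (ν : ℤ) :
    Nonempty (Homotopy (s ^ g • 𝟙 (B Φ ν)) 0) := by
  by_cases h1 : ν < 0
  · rw [B, if_pos h1]
    exact nonempty_homotopy_complexH hw h1
  by_cases h2 : ν ≤ (f : ℤ) - g
  · rw [B, if_neg h1, if_pos h2]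
    exact nonempty_homotopy_complexSplice hw ν
  · rw [B, if_neg h1, if_neg h2]
    exact nonempty_homotopy_complexS hw (not_le.1 h2)

/-! ### Annihilators of the homology -/

lemma smul_homology_eq_zero {C : ChainComplex (ModuleCat.{u} R) ℤ} {r : R}
    (h : Homotopy (r • 𝟙 C) 0) (i : ℤ) (x : C.homology i) : r • x = 0 := by
  have h1 : HomologicalComplex.homologyMap (r • 𝟙 C) i = r • 𝟙 (C.homology i) := by
    rw [← HomologicalComplex.homologyMap_id]
    exact ShortComplex.homologyMap_smul
      ((HomologicalComplex.shortComplexFunctor _ _ i).map (𝟙 C)) r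
  rw [h.homologyMap_eq, HomologicalComplex.homologyMap_zero] at h1
  exact (LinearMap.congr_fun (congrArg ModuleCat.Hom.hom h1) x).symm

lemma map_smul_id (L : Type u) [AddCommGroup L] [Module R L] (C : ChainComplex (ModuleCat.{u} R) ℤ)
    (r : R) :
    ((MonoidalCategory.tensorRight (ModuleCat.of R L)).mapHomologicalComplex _).map (r • 𝟙 C) =
      r • 𝟙 _ := by
  ext i : 1
  have h := (MonoidalCategory.tensorRight (ModuleCat.of R L)).map_smul r (𝟙 (C.X i))
  rw [CategoryTheory.Functor.map_id] at h
  exact h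

/-- Tensoring with `L` is an `R`-linear functor, so it carries the null-homotopy of `s ^ g` along,
and homotopic maps agree on homology. -/
lemma smul_homology_BL_eq_zero {Φ : Matrix (Fin g) (Fin f) R} {w : Fin g → Fin f → R} {s : R}
    (hw : ∀ k i, row Φ k (w i) = if k = i then s else 0) (L : Type u) [AddCommGroup L] [Module R L]
    (i ν : ℤ) (x : (BL Φ L ν).homology i) : s ^ g • x = 0 := by
  obtain ⟨h⟩ := nonempty_homotopy_B hw ν
  have h' := (MonoidalCategory.tensorRight (ModuleCat.of R L)).mapHomotopy h
  rw [map_smul_id, CategoryTheory.Functor.map_zero] at h'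
  exact smul_homology_eq_zero h' i x

lemma smul_homology_BL_eq_zero_of_annihilates (Φ : Matrix (Fin g) (Fin f) R) (L : Type u)
    [AddCommGroup L] [Module R L] {s : R} (hs : ∀ y : L, s • y = 0) (i ν : ℤ)
    (x : (BL Φ L ν).homology i) : s • x = 0 := by
  refine smul_homology_eq_zero (Homotopy.ofEq ?_) i x
  ext j : 1
  refine ModuleCat.hom_ext (LinearMap.ext fun z => ?_)
  change s • (show ((B Φ ν).X j) ⊗[R] L from z) = 0
  induction (show ((B Φ ν).X j) ⊗[R] L from z) using TensorProduct.induction_on with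
  | zero => exact smul_zero _
  | tmul a b => rw [← TensorProduct.tmul_smul, hs, TensorProduct.tmul_zero]
  | add a b ha hb => rw [smul_add, ha, hb, add_zero]

/-- If `s` annihilates the cokernel of `Φ`, then `s` times the identity factors through `Φ`. -/
lemma exists_row_eq {Φ : Matrix (Fin g) (Fin f) R} {s : R} (hs : ∀ y : coker Φ, s • y = 0) :
    ∃ w : Fin g → Fin f → R, ∀ k i, row Φ k (w i) = if k = i then s else 0 := by
  have h (i : Fin g) : ∃ v, Φ.mulVecLin v = s • Pi.single i 1 := by
    have := hs (Submodule.Quotient.mk (Pi.single i 1))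
    rwa [← Submodule.Quotient.mk_smul, Submodule.Quotient.mk_eq_zero] at this
  choose w hw using h
  refine ⟨w, fun k i => ?_⟩
  have := congrFun (hw i) k
  simpa [row, Matrix.mulVec, dotProduct, Pi.single_apply] using this

/-! ### Supports -/

/-- For finite modules the support is detected on fibres. The fibre of `M ⊗ N` is the tensor product
over the residue field of the two fibres, and nonzero vector spaces have a nonzero tensor product.
-/
lemma notMem_support_or_of_notMem_support_tensorProduct {A : Type*} [CommRing A] {M N : Type*}
    [AddCommGroup M] [Module A M] [Module.Finite A M] [AddCommGroup N] [Module A N]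
    [Module.Finite A N] {p : PrimeSpectrum A} (h : p ∉ Module.support A (M ⊗[A] N)) :
    p ∉ Module.support A M ∨ p ∉ Module.support A N := by
  contrapose! h
  obtain ⟨hM, hN⟩ := h
  rw [Module.mem_support_iff_nontrivial_residueField_tensorProduct] at hM hN ⊢
  rw [(AlgebraTensorModule.distribBaseChange A p.asIdeal.ResidueField M N).toEquiv.nontrivial_congr]
  infer_instance

/-- The support of a finite module is the zero locus of its annihilator, so one element works for
all `m` at once. -/
lemma exists_annihilates_of_notMem_support {A : Type*} [CommRing A] {M : Type*}
    [AddCommGroup M] [Module A M] [Module.Finite A M] {p : PrimeSpectrum A}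
    (h : p ∉ Module.support A M) : ∃ s ∉ p.asIdeal, ∀ m : M, s • m = 0 := by
  rw [Module.mem_support_iff_of_finite, SetLike.not_le_iff_exists] at h
  obtain ⟨s, hs, hsp⟩ := h
  exact ⟨s, hsp, Module.mem_annihilator.1 hs⟩

end KoszulCech

end

/-! ### The inclusion of supports -/

theorem mainTheorem4 {R : Type u} [CommRing R] {f g : ℕ} (hfg : g ≤ f)
    (Φ : Matrix (Fin g) (Fin f) R) (L : Type u) [AddCommGroup L] [Module R L] [Module.Finite R L]
    (i ν : ℤ) :
    Module.support R ((KoszulCech.BL Φ L ν).homology i) ⊆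
      Module.support R (KoszulCech.coker Φ ⊗[R] L) := by
  intro p hp
  by_contra h
  -- A single element outside `p` that kills the homology makes its localization at `p` vanish,
  -- without any finiteness of the homology.
  suffices h' : ∃ t ∉ p.asIdeal, ∀ x : (KoszulCech.BL Φ L ν).homology i, t • x = 0 by
    obtain ⟨t, ht, hx⟩ := h'
    exact Module.notMem_support_iff'.2 (fun x => ⟨t, ht, hx x⟩) hp
  rcases KoszulCech.notMem_support_or_of_notMem_support_tensorProduct h with h | h
  · obtain ⟨s, hs, hM⟩ := KoszulCech.exists_annihilates_of_notMem_support h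
    obtain ⟨w, hw⟩ := KoszulCech.exists_row_eq hM
    exact ⟨s ^ g, fun h => hs (p.isPrime.mem_of_pow_mem _ h),
      KoszulCech.smul_homology_BL_eq_zero hw L i ν⟩
  · obtain ⟨s, hs, hL⟩ := KoszulCech.exists_annihilates_of_notMem_support h
    exact ⟨s, hs, KoszulCech.smul_homology_BL_eq_zero_of_annihilates Φ L hL i ν⟩
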